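/- Let $\Bbbk$ be a field and $m$ an integer with $m > 2$. Let $\mathrm{TL}_{m-1}(0)$ be the Temperley–Lieb algebra over $\Bbbk$ on $m-1$ strands with loop parameter $0$: it has as basis the crossingless matchings of $m-1$ points on the bottom and $m-1$ points on the top of a planar strip, and the product of two matchings is obtained by stacking them, the result being $0$ if a closed loop appears. The Jones–Wenzl projector, if it exists, is the (unique) element of $\mathrm{TL}_{m-1}(0)$ in which the identity diagram has coefficient $1$ and which is annihilated by left and right multiplication with each generator $e_i$ (the diagram with a cap joining the bottom points $i,i+1$, a cup joining the top points $i,i+1$, and vertical strands elsewhere), $1\le i\le m-2$. It is called rotatable if its rotations by one strand, clockwise and counterclockwise, are scalar multiples of it. Then the Jones–Wenzl projector in $\mathrm{TL}_{m-1}(0)$ exists and is rotatable if and only if $\Bbbk$ has positive characteristic $p$ and $m = 2p^k$ for some integer $k > 0$. -/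

import Mathlib

/-- A *Temperley-Lieb diagram* on `n` strands: a crossingless matching of the `2 n` boundary
points of a planar strip, with `n` points at the bottom and `n` points at the top.

The boundary points are numbered counterclockwise by `Fin (2 * n)`, starting at the bottom left
corner: position `x < n` is the point number `x` of the bottom row (counted from the left, starting
with `0`), and position `2 * n - 1 - x` (that is, `Fin.rev x`) is the point number `x` of the top
row (again counted from the left). -/
@[ext]
structure TLDiagram (n : ℕ) where
  /-- the point joined to a given boundary point -/
  partner : Fin (2 * n) → Fin (2 * n)
  partner_partner : ∀ x, partner (partner x) = x
  partner_ne : ∀ x, partner x ≠ x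
  /-- no two arcs cross -/
  noncrossing : ∀ x y, ¬ (x < y ∧ y < partner x ∧ partner x < partner y)

namespace TLDiagram

variable {n : ℕ}

/-- The identity diagram: `n` vertical strands. -/
def one (n : ℕ) : TLDiagram n where
  partner := Fin.rev
  partner_partner := Fin.rev_rev
  partner_ne x h := by
    have := congrArg Fin.val h
    rw [Fin.val_rev] at this
    omega
  noncrossing x y h := by
    simp only [Fin.lt_def, Fin.val_rev] at h
    omega

/-- The arcs of the diagram `cupCap n i hi` below. -/
def cupCapPartner (n i : ℕ) (hi : i + 1 < n) (x : Fin (2 * n)) : Fin (2 * n) :=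
  if x.val = i then ⟨i + 1, by omega⟩
  else if x.val = i + 1 then ⟨i, by omega⟩
  else if x.val = 2 * n - 1 - i then ⟨2 * n - 2 - i, by omega⟩
  else if x.val = 2 * n - 2 - i then ⟨2 * n - 1 - i, by omega⟩
  else x.rev

theorem cupCapPartner_val (n i : ℕ) (hi : i + 1 < n) (x : Fin (2 * n)) :
    (cupCapPartner n i hi x).val =
      if x.val = i then i + 1
      else if x.val = i + 1 then i
      else if x.val = 2 * n - 1 - i then 2 * n - 2 - i
      else if x.val = 2 * n - 2 - i then 2 * n - 1 - i
      else 2 * n - 1 - x.val := by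
  unfold cupCapPartner
  split_ifs <;> simp only [Fin.val_rev]
  omega

/-- The generating diagram of the Temperley-Lieb algebra with a cap joining the bottom points
`i` and `i + 1`, a cup joining the top points `i` and `i + 1`, and vertical strands elsewhere
(points of a row are counted from the left, starting with `0`). -/
def cupCap (n i : ℕ) (hi : i + 1 < n) : TLDiagram n where
  partner := cupCapPartner n i hi
  partner_partner x := by
    have hx := x.isLt
    apply Fin.ext
    simp only [cupCapPartner_val]
    split_ifs <;> omega
  partner_ne x h := by
    have hx := x.isLt
    have h' := congrArg Fin.val h
    rw [cupCapPartner_val] at h'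
    split_ifs at h' <;> omega
  noncrossing x y h := by
    have hx := x.isLt
    have hy := y.isLt
    simp only [Fin.lt_def, cupCapPartner_val] at h
    split_ifs at h <;> omega

/-! ### Rotation -/

theorem finRotate_val {N : ℕ} (x : Fin N) :
    (finRotate N x).val = if x.val + 1 = N then 0 else x.val + 1 := by
  cases N with
  | zero => exact x.elim0
  | succ N =>
    rw [coe_finRotate]
    have hx := x.isLt
    by_cases h : x = Fin.last N
    · subst h
      simp
    · have h' : x.val ≠ N := fun e => h (Fin.ext e)
      rw [if_neg h, if_neg (by omega)]

/-- Rotation by one strand, counterclockwise: every boundary point moves to the next position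
in the counterclockwise order (so the last bottom point becomes the last top point, and the first
top point becomes the first bottom point). -/
def rotateCCW (D : TLDiagram n) : TLDiagram n where
  partner x := finRotate (2 * n) (D.partner ((finRotate (2 * n)).symm x))
  partner_partner x := by rw [Equiv.symm_apply_apply, D.partner_partner, Equiv.apply_symm_apply]
  partner_ne x h := by
    rw [← Equiv.eq_symm_apply] at h
    exact D.partner_ne _ h
  noncrossing x y h := by
    obtain ⟨a, rfl⟩ := (finRotate (2 * n)).surjective x
    obtain ⟨b, rfl⟩ := (finRotate (2 * n)).surjective y
    simp only [Equiv.symm_apply_apply] at h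
    have h1 := D.noncrossing a b
    have h2 := D.noncrossing b (D.partner a)
    rw [partner_partner] at h2
    have ha := a.isLt
    have hb := b.isLt
    have hpa := (D.partner a).isLt
    have hpb := (D.partner b).isLt
    simp only [Fin.lt_def, finRotate_val] at h h1 h2
    split_ifs at h <;> omega

/-- Rotation by one strand, clockwise: the inverse of `rotateCCW`. -/
def rotateCW (D : TLDiagram n) : TLDiagram n where
  partner x := (finRotate (2 * n)).symm (D.partner (finRotate (2 * n) x))
  partner_partner x := by rw [Equiv.apply_symm_apply, D.partner_partner, Equiv.symm_apply_apply]
  partner_ne x h := by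
    rw [Equiv.symm_apply_eq] at h
    exact D.partner_ne _ h
  noncrossing x y h := by
    obtain ⟨a, ha'⟩ : ∃ a, a = (finRotate (2 * n)).symm (D.partner (finRotate (2 * n) x)) :=
      ⟨_, rfl⟩
    obtain ⟨b, hb'⟩ : ∃ b, b = (finRotate (2 * n)).symm (D.partner (finRotate (2 * n) y)) :=
      ⟨_, rfl⟩
    rw [← ha', ← hb'] at h
    rw [Equiv.eq_symm_apply] at ha' hb'
    have h1 := D.noncrossing (finRotate (2 * n) x) (finRotate (2 * n) y)
    have h2 := D.noncrossing (D.partner (finRotate (2 * n) y)) (finRotate (2 * n) x)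
    rw [partner_partner] at h2
    rw [← ha', ← hb'] at h1 h2
    have hx := x.isLt
    have hy := y.isLt
    have ha := a.isLt
    have hb := b.isLt
    simp only [Fin.lt_def, finRotate_val] at h h1 h2
    split_ifs at h1 h2 <;> omega

/-! ### Composition -/

/-- The graph obtained by stacking the diagram `A` on top of the diagram `B`. Its vertices are the
boundary points of `A` (`Sum.inl`) and of `B` (`Sum.inr`); its edges are the arcs of `A`, the arcs
of `B`, and, for every `i`, an edge that glues the `i`-th bottom point of `A` to the `i`-th top
point of `B`. -/
def stack (A B : TLDiagram n) : SimpleGraph (Fin (2 * n) ⊕ Fin (2 * n)) :=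
  SimpleGraph.fromRel fun u v =>
    match u, v with
    | Sum.inl x, Sum.inl y => A.partner x = y
    | Sum.inr x, Sum.inr y => B.partner x = y
    | Sum.inl x, Sum.inr y => x.val < n ∧ y = x.rev
    | Sum.inr _, Sum.inl _ => False

/-- The outer boundary points of the stacked picture: the bottom points of the lower diagram and
the top points of the upper diagram. -/
def outer (x : Fin (2 * n)) : Fin (2 * n) ⊕ Fin (2 * n) :=
  if x.val < n then Sum.inr x else Sum.inl x

/-- `D` is the diagram obtained by stacking `A` on top of `B` and removing the closed loops: two
different boundary points are joined in `D` exactly if they are connected in the stacked picture. -/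
def IsComposite (A B D : TLDiagram n) : Prop :=
  ∀ x y, D.partner x = y ↔ x ≠ y ∧ (stack A B).Reachable (outer x) (outer y)

/-- The number of closed loops when `A` is stacked on top of `B`: the number of connected
components which do not meet the outer boundary. -/
noncomputable def loops (A B : TLDiagram n) : ℕ :=
  Nat.card {c : (stack A B).ConnectedComponent //
    ∀ x, c ≠ (stack A B).connectedComponentMk (outer x)}

theorem IsComposite.unique {A B D D' : TLDiagram n} (h : IsComposite A B D)
    (h' : IsComposite A B D') : D = D' :=
  TLDiagram.ext (funext fun x => (((h' x _).2 ((h x _).1 rfl))).symm)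

end TLDiagram

/-- The underlying module of the Temperley-Lieb algebra on `n` strands: formal linear combinations
of Temperley-Lieb diagrams. -/
abbrev TL (K : Type*) [Field K] (n : ℕ) := TLDiagram n →₀ K

namespace TL

variable {K : Type*} [Field K] {n : ℕ}

open Classical in
/-- The product of two diagrams in the Temperley-Lieb algebra with loop parameter `δ`: stack the
first on top of the second, and replace each closed loop by the factor `δ`. (By planarity, the
composite diagram always exists, and it is unique.) -/
noncomputable def diagramMul (δ : K) (A B : TLDiagram n) : TL K n :=
  if h : ∃ D, TLDiagram.IsComposite A B D then Finsupp.single h.choose (δ ^ TLDiagram.loops A B)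
  else 0

/-- The multiplication of the Temperley-Lieb algebra with loop parameter `δ`: the bilinear
extension of the product of diagrams. -/
noncomputable def mul (δ : K) (X Y : TL K n) : TL K n :=
  X.sum fun A a => Y.sum fun B b => (a * b) • diagramMul δ A B

/-- The generator of the Temperley-Lieb algebra given by the diagram `TLDiagram.cupCap`. -/
noncomputable def gen (K : Type*) [Field K] (n i : ℕ) (hi : i + 1 < n) : TL K n :=
  Finsupp.single (TLDiagram.cupCap n i hi) 1

/-- `X` is the Jones-Wenzl projector of the Temperley-Lieb algebra on `n` strands with loop
parameter `δ`: the coefficient of the identity diagram is `1`, and `X` is annihilated on both sides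
by all the generators. -/
structure IsJonesWenzl (δ : K) (X : TL K n) : Prop where
  coeff_one : X (TLDiagram.one n) = 1
  gen_mul : ∀ (i : ℕ) (hi : i + 1 < n), mul δ (gen K n i hi) X = 0
  mul_gen : ∀ (i : ℕ) (hi : i + 1 < n), mul δ X (gen K n i hi) = 0

/-- `X` is rotatable: both rotations of `X` by one strand (extended linearly from diagrams) are
scalar multiples of `X`. -/
def IsRotatable (X : TL K n) : Prop :=
  (∃ c : K, Finsupp.mapDomain TLDiagram.rotateCCW X = c • X) ∧
    ∃ c : K, Finsupp.mapDomain TLDiagram.rotateCW X = c • X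

end TL

/-! Diagrams on `n = m - 1` strands are modelled at loop parameter `0` by free fermions. A diagram
is sent to a function on the `n`-element subsets of the `2 * n` boundary points, supported on the
sets that contain exactly one endpoint of every arc. Its value is a product of signs, one for each
chosen endpoint: `1` at an even endpoint, and `(-1) ^ ((ℓ - 1) / 2)` at an odd endpoint of an arc of
length `ℓ`. This linear map `cupMap` is injective, since it is triangular with respect to sets of
left endpoints (`eq_zero_of_cupMap`). Up to values at sets of other sizes, its image is the common
kernel of the alternating sums over all `T` with `#T > n` (`altSum_cupSpan`, `exists_mem_cupSpan`).

Multiplication by a generator is the capping of two neighbouring boundary points. On vectors,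
capping `a` and `a + 1` is the difference of the values at `S` and at `S` with `a` moved to `a + 1`
(`cupMap_sub_cupMap`). So an element is annihilated by all caps exactly if its vector is constant on
`n`-subsets.

The Jones-Wenzl conditions give all caps between consecutive positions except the one joining the
last bottom point to the last top point; rotatability supplies that one. Hence a rotatable projector
has a nonzero constant vector, and the constant function `1` passes all alternating tests: the
Gaussian binomials at `-1` of `n + k` over `n` vanish for `1 ≤ k ≤ n`. Conversely, if they vanish,
`1` comes from an element annihilated by all caps. Its coefficient at the identity is nonzero
(`cupMap_range`), and for odd `n` its rotation is forced to be proportional to it.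

What remains is arithmetic (`altChoose_eq_zero_iff`). For even `n` the case `k = 1` fails. For `n =
2 * t + 1` the condition says that the binomials of `t + j` over `t` vanish in `K` for `1 ≤ j ≤ t`,
which means that `t + 1` is a positive power of the characteristic. -/

/-! ### Alternating sums over subsets -/

section AlternatingSums

open Finset

/-- The sum over the elements of `S` of their ranks in `T`. -/
def rankSum (T S : Finset ℕ) : ℕ := ∑ s ∈ S, #{t ∈ T | t < s}

/-- The alternating sum of the values of a function on the `n`-element subsets of `T`. -/
noncomputable def altSum (K : Type*) [Field K] (n : ℕ) (T : Finset ℕ) :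
    (Finset ℕ → K) →ₗ[K] K :=
  ∑ S ∈ T.powersetCard n, (-1 : K) ^ rankSum T S • LinearMap.proj S

variable {K : Type*} [Field K]

theorem altSum_apply (n : ℕ) (T : Finset ℕ) (u : Finset ℕ → K) :
    altSum K n T u = ∑ S ∈ T.powersetCard n, (-1 : K) ^ rankSum T S * u S := by
  simp [altSum, LinearMap.sum_apply]

theorem altSum_zero (T : Finset ℕ) (u : Finset ℕ → K) : altSum K 0 T u = u ∅ := by
  simp [altSum_apply, rankSum]

theorem altSum_congr {n : ℕ} {T : Finset ℕ} {u v : Finset ℕ → K}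
    (h : ∀ S ⊆ T, #S = n → u S = v S) : altSum K n T u = altSum K n T v := by
  rw [altSum_apply, altSum_apply]
  refine sum_congr rfl fun S hS => ?_
  rw [mem_powersetCard] at hS
  rw [h S hS.1 hS.2]

theorem altSum_eq_zero {n : ℕ} {T : Finset ℕ} {u : Finset ℕ → K}
    (h : ∀ S ⊆ T, #S = n → u S = 0) : altSum K n T u = 0 := by
  rw [altSum_congr (v := 0) (by simpa using h), map_zero]

theorem altSum_self (T : Finset ℕ) (u : Finset ℕ → K) :
    altSum K #T T u = (-1) ^ rankSum T T * u T := by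
  simp [altSum_apply]

theorem rankSum_insert_left {M : ℕ} {T S : Finset ℕ} (hS : S ⊆ range M) :
    rankSum (insert M T) S = rankSum T S := by
  refine sum_congr rfl fun s hs => ?_
  have := mem_range.1 (hS hs)
  rw [filter_insert, if_neg (by omega)]

theorem rankSum_insert_insert {M : ℕ} {T S : Finset ℕ} (hT : T ⊆ range M) (hS : S ⊆ range M) :
    rankSum (insert M T) (insert M S) = #T + rankSum T S := by
  have hM : M ∉ S := fun h => by simpa using hS h
  rw [rankSum, sum_insert hM]
  congr 1
  · rw [filter_insert, if_neg (lt_irrefl M), filter_true_of_mem fun t ht => mem_range.1 (hT ht)]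
  · exact rankSum_insert_left hS

/-- The new largest point `M` has rank `#T` and does not affect the other ranks. This splitting
drives all inductions on the number of points. -/
theorem altSum_insert {M : ℕ} {T : Finset ℕ} (hT : T ⊆ range M) (n : ℕ) (u : Finset ℕ → K) :
    altSum K (n + 1) (insert M T) u =
      altSum K (n + 1) T u + (-1) ^ #T * altSum K n T (fun S => u (insert M S)) := by
  have hM : M ∉ T := fun h => by simpa using hT h
  rw [altSum_apply, powersetCard_succ_insert hM, sum_union, altSum_apply, altSum_apply, mul_sum,
    sum_image]
  · congr 1
    · refine sum_congr rfl fun S hS => ?_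
      rw [rankSum_insert_left ((mem_powersetCard.1 hS).1.trans hT)]
    · refine sum_congr rfl fun S hS => ?_
      rw [rankSum_insert_insert hT ((mem_powersetCard.1 hS).1.trans hT), pow_add, mul_assoc]
  · intro S hS S' hS' h
    have h1 : M ∉ S := fun h => hM ((mem_powersetCard.1 hS).1 h)
    have h2 : M ∉ S' := fun h => hM ((mem_powersetCard.1 hS').1 h)
    rw [← erase_insert h1, ← erase_insert h2]
    exact congrArg (fun A => A.erase M) h
  · rw [disjoint_left]
    intro S hS hS'
    obtain ⟨S', -, rfl⟩ := mem_image.1 hS'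
    exact hM ((mem_powersetCard.1 hS).1 (mem_insert_self _ _))

/-- A subset of `range (M + 1)` either avoids `M`, or is obtained by inserting `M`. -/
theorem subset_range_succ_cases {M n : ℕ} {S : Finset ℕ} (hS : S ⊆ range (M + 1)) (hc : #S = n) :
    S ⊆ range M ∨ ∃ S' ⊆ range M, #S' + 1 = n ∧ S = insert M S' := by
  by_cases hM : M ∈ S
  · refine .inr ⟨S.erase M, fun x hx => ?_, ?_, (insert_erase hM).symm⟩
    · have h1 := mem_erase.1 hx
      have h2 := mem_range.1 (hS h1.2)
      rw [mem_range]
      omega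
    · rw [card_erase_add_one hM, hc]
  · refine .inl fun x hx => ?_
    have h2 := mem_range.1 (hS hx)
    have h3 : x ≠ M := fun h => hM (h ▸ hx)
    rw [mem_range]
    omega

theorem card_insert_of_subset_range {M : ℕ} {T : Finset ℕ} (hT : T ⊆ range M) :
    #(insert M T) = #T + 1 :=
  card_insert_of_notMem fun h => by simpa using hT h

theorem insert_subset_range_succ {M : ℕ} {T : Finset ℕ} (hT : T ⊆ range M) :
    insert M T ⊆ range (M + 1) := by
  rw [range_add_one]
  exact insert_subset_insert _ hT

/-- A function of negative weight annihilated by sufficiently many alternating sums vanishes. -/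
theorem eq_zero_of_altSum_eq_zero (M : ℕ) : ∀ (n r : ℕ) (u : Finset ℕ → K), 2 * n + r ≤ M →
    (∀ T ⊆ range M, n + r ≤ #T → altSum K n T u = 0) → ∀ S ⊆ range M, #S = n → u S = 0 := by
  induction M with
  | zero =>
    intro n r u hn hu S hS hc
    have h := hu ∅ (by simp) (by simp; omega)
    obtain rfl : n = 0 := by omega
    rw [card_eq_zero] at hc
    rwa [hc, ← altSum_zero ∅ u]
  | succ M ih =>
    intro n r u hn hu S hS hc
    obtain _ | n := n
    · have h := hu (range (M + 1)) subset_rfl (by simp; omega)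
      rw [card_eq_zero] at hc
      rwa [hc, ← altSum_zero _ u]
    have hins : ∀ T ⊆ range M, n + r ≤ #T →
        altSum K (n + 1) T u + (-1) ^ #T * altSum K n T (fun S => u (insert M S)) = 0 := by
      intro T hT h
      rw [← altSum_insert hT]
      refine hu _ (insert_subset_range_succ hT) ?_
      rw [card_insert_of_subset_range hT]
      omega
    have hsub : ∀ T ⊆ range M, n + 1 + r ≤ #T → altSum K (n + 1) T u = 0 := fun T hT h =>
      hu T (hT.trans (range_mono (by omega))) h
    have key : (∀ S ⊆ range M, #S = n + 1 → u S = 0) ∧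
        ∀ S ⊆ range M, #S = n → u (insert M S) = 0 := by
      -- Away from the boundary of the inequality, the sets avoiding `M` are settled first with the
      -- same `r`. On the boundary, the sets containing `M` come first, with `r + 1`.
      by_cases hlt : 2 * (n + 1) + r ≤ M
      · have h0 := ih (n + 1) r u hlt hsub
        refine ⟨h0, ih n r (fun S => u (insert M S)) (by omega) fun T hT h => ?_⟩
        have := hins T hT h
        rw [altSum_eq_zero fun S hS => h0 S (hS.trans hT), zero_add] at this
        simpa using this
      · have h0 := ih n (r + 1) (fun S => u (insert M S)) (by omega) fun T hT h => by
          have := hins T hT (by omega)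
          rw [hsub T hT (by omega), zero_add] at this
          simpa using this
        refine ⟨?_, h0⟩
        -- For `r = 0` a set `T` with exactly `n + 1` elements is itself an admissible test, and its
        -- alternating sum has a single term. Otherwise `r` can be lowered by one.
        obtain _ | r := r
        · intro S hS hc
          have := hsub S hS (by omega)
          rw [← hc, altSum_self] at this
          simpa using this
        · refine ih (n + 1) r u (by omega) fun T hT h => ?_
          have := hins T hT (by omega)
          rwa [altSum_eq_zero fun S hS => h0 S (hS.trans hT), mul_zero, add_zero] at this
    obtain h | ⟨S', h, hc', rfl⟩ := subset_range_succ_cases hS hc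
    · exact key.1 S h hc
    · exact key.2 S' h (by omega)

/-! ### Gaussian binomial coefficients at `-1` -/

variable (K) in
/-- The Gaussian binomial coefficient at `-1`, up to sign. -/
def altChoose : ℕ → ℕ → K
  | _, 0 => 1
  | 0, _ + 1 => 0
  | t + 1, n + 1 => altChoose t (n + 1) + (-1) ^ t * altChoose t n

/-- The test of a constant function depends only on `#T`, so membership of constants in the kernel
is a question of arithmetic. -/
theorem altSum_one (n : ℕ) (T : Finset ℕ) : altSum K n T (fun _ => 1) = altChoose K #T n := by
  induction T using Finset.induction_on_max generalizing n with
  | empty =>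
    obtain _ | n := n
    · simp [altSum_zero, altChoose]
    · rw [altSum_apply, powersetCard_eq_empty.2 (by simp), sum_empty, card_empty, altChoose]
  | insert M T hM ih =>
    have hT : T ⊆ range M := fun x hx => mem_range.2 (hM x hx)
    rw [card_insert_of_subset_range hT]
    obtain _ | n := n
    · simp [altSum_zero, altChoose]
    · rw [altSum_insert hT, ih, ih, altChoose]

/-- Two consecutive Pascal steps have opposite signs, so the middle terms cancel. In terms of
generating functions, the product of `1 + x` and `1 - x` is `1 - x ^ 2`. -/
theorem altChoose_even (t : ℕ) : (∀ j, altChoose K (2 * t) (2 * j) = (-1) ^ j * (t.choose j : K)) ∧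
    ∀ j, altChoose K (2 * t) (2 * j + 1) = 0 := by
  induction t with
  | zero =>
    refine ⟨fun j => ?_, fun j => by simp [altChoose]⟩
    obtain _ | j := j
    · simp [altChoose]
    · simp [altChoose, mul_add]
  | succ t ih =>
    have he : ((-1 : K)) ^ (2 * t) = 1 := by rw [pow_mul]; simp
    have ho : ((-1 : K)) ^ (2 * t + 1) = -1 := by rw [pow_succ, he, one_mul]
    have hs : ∀ i, 2 * (i + 1) = 2 * i + 1 + 1 := fun i => by omega
    refine ⟨fun j => ?_, fun j => ?_⟩
    · obtain _ | j := j
      · simp [altChoose]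
      · have h1 := ih.1 (j + 1)
        rw [hs] at h1
        rw [hs, hs, altChoose, altChoose, altChoose, h1, ih.1, ih.2, he, ho,
          Nat.choose_succ_succ', pow_succ]
        push_cast
        ring
    · obtain _ | j := j
      · have h1 := ih.2 0
        simp only [mul_zero, zero_add] at h1 ⊢
        rw [hs, altChoose, altChoose, altChoose, h1, he, ho]
        simp [altChoose]
      · have h1 := ih.2 (j + 1)
        have h2 := ih.1 (j + 1)
        rw [hs] at h1 h2
        rw [hs, hs, altChoose, altChoose, altChoose, h1, h2, ih.2, he, ho]
        ring

theorem altChoose_odd_even (t j : ℕ) :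
    altChoose K (2 * t + 1) (2 * j) = (-1) ^ j * (t.choose j : K) := by
  obtain _ | j := j
  · simp [altChoose]
  · rw [← (altChoose_even t).1, mul_add, mul_one, altChoose, (altChoose_even t).2]
    simp

theorem altChoose_odd_odd (t j : ℕ) :
    altChoose K (2 * t + 1) (2 * j + 1) = (-1) ^ j * (t.choose j : K) := by
  rw [altChoose, (altChoose_even t).2, (altChoose_even t).1, pow_mul]
  simp

end AlternatingSums

/-! ### Noncrossing partial matchings -/

section Cups

open Finset

/-- `π` is a noncrossing partial matching of the points `0, …, M - 1`, in which `n` points are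
left endpoints of arcs or unmatched, and no unmatched point lies below an arc. -/
structure IsCups (M n : ℕ) (π : ℕ → ℕ) : Prop where
  invol : ∀ x, π (π x) = x
  fix : ∀ x, M ≤ x → π x = x
  nest : ∀ x y, x < y → y < π x → x < π y ∧ π y < π x ∧ π y ≠ y
  card : #{x ∈ range M | x ≤ π x} = n

/-- `S` contains all unmatched points and exactly one endpoint of every arc. -/
def IsTransversal (M : ℕ) (π : ℕ → ℕ) (S : Finset ℕ) : Prop :=
  ∀ x < M, (π x = x → x ∈ S) ∧ (π x ≠ x → (π x ∈ S ↔ x ∉ S))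

variable {K : Type*} [Field K]

variable (K) in
/-- The sign attached to an endpoint of an arc. -/
def arcSign (π : ℕ → ℕ) (x : ℕ) : K := if Odd x then (-1) ^ (Nat.dist x (π x) / 2) else 1

variable (K) in
open Classical in
/-- The vector of the exterior algebra (in the coordinates given by finite sets) that is attached
to a partial matching. -/
noncomputable def cupVec (M : ℕ) (π : ℕ → ℕ) (S : Finset ℕ) : K :=
  if IsTransversal M π S then ∏ x ∈ S, arcSign K π x else 0

theorem cupVec_of_transversal {M : ℕ} {π : ℕ → ℕ} {S : Finset ℕ} (h : IsTransversal M π S) :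
    cupVec K M π S = ∏ x ∈ S, arcSign K π x := if_pos h

theorem cupVec_of_not_transversal {M : ℕ} {π : ℕ → ℕ} {S : Finset ℕ} (h : ¬ IsTransversal M π S) :
    cupVec K M π S = 0 := if_neg h

theorem arcSign_ne_zero (π : ℕ → ℕ) (x : ℕ) : arcSign K π x ≠ 0 := by
  unfold arcSign
  split_ifs <;> simp

theorem arcSign_of_fixed {π : ℕ → ℕ} {x : ℕ} (h : π x = x) : arcSign K π x = 1 := by
  simp [arcSign, h]

theorem cupVec_ne_zero {M : ℕ} {π : ℕ → ℕ} {S : Finset ℕ} (h : IsTransversal M π S) :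
    cupVec K M π S ≠ 0 := by
  rw [cupVec_of_transversal h]
  exact prod_ne_zero_iff.2 fun x _ => arcSign_ne_zero π x

namespace IsCups

variable {M n : ℕ} {π : ℕ → ℕ}

theorem lt (h : IsCups M n π) {x : ℕ} (hx : x < M) : π x < M := by
  by_contra hc
  have := h.fix _ (not_lt.1 hc)
  rw [h.invol] at this
  omega

/-- By nesting, `π` preserves the open interval below the arc and has no fixed point there, so it
exchanges the points in `S` with those outside. -/
theorem two_mul_card_interior (h : IsCups M n π) {a : ℕ} (hb : π a < M) {S : Finset ℕ}
    (hS : IsTransversal M π S) : 2 * #{x ∈ Ioo a (π a) | x ∈ S} = π a - a - 1 := by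
  have hin : ∀ x, x ∈ Ioo a (π a) → π x ∈ Ioo a (π a) ∧ π x ≠ x := by
    intro x hx
    rw [mem_Ioo] at hx ⊢
    have := h.nest a x hx.1 hx.2
    exact ⟨⟨this.1, this.2.1⟩, this.2.2⟩
  have hM : ∀ x, x ∈ Ioo a (π a) → x < M := fun x hx => (mem_Ioo.1 hx).2.trans hb
  have h1 : #{x ∈ Ioo a (π a) | x ∈ S} = #{x ∈ Ioo a (π a) | x ∉ S} := by
    refine card_nbij' π π ?_ ?_ (fun x _ => h.invol x) (fun x _ => h.invol x)
    · intro x hx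
      simp only [coe_filter, Set.mem_ofPred_eq] at hx ⊢
      refine ⟨(hin x hx.1).1, fun hc => ?_⟩
      exact (((hS x (hM x hx.1)).2 (hin x hx.1).2).1 hc) hx.2
    · intro x hx
      simp only [coe_filter, Set.mem_ofPred_eq] at hx ⊢
      exact ⟨(hin x hx.1).1, ((hS x (hM x hx.1)).2 (hin x hx.1).2).2 hx.2⟩
  have h2 := card_filter_add_card_filter_not (s := Ioo a (π a)) (fun x => x ∈ S)
  rw [Nat.card_Ioo] at h2
  omega

theorem isTransversal_openers (h : IsCups M n π) :
    IsTransversal M π {x ∈ range M | x ≤ π x} := by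
  intro x hx
  have := h.lt hx
  simp only [mem_filter, mem_range, h.invol, hx, this, true_and]
  omega

theorem odd_sub (h : IsCups M n π) {a : ℕ} (hb : π a < M) (hab : a < π a) : Odd (π a - a) := by
  have := h.two_mul_card_interior hb h.isTransversal_openers
  rw [Nat.odd_iff]
  omega

/-- Moving a point of a transversal along an arc. -/
theorem cupVec_flip (h : IsCups M n π) {a : ℕ} (hb : π a < M) (hab : a < π a) {S : Finset ℕ}
    (hS : IsTransversal M π S) (ha : a ∈ S) :
    cupVec K M π (insert (π a) (S.erase a)) = (-1) ^ #{x ∈ Ioo a (π a) | x ∈ S} * cupVec K M π S := by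
  have hbS : π a ∉ S := fun hc => (((hS a (hab.trans hb)).2 hab.ne').1 hc) ha
  have hS' : IsTransversal M π (insert (π a) (S.erase a)) := by
    intro x hx
    have hx' := hS x hx
    have e1 : π x = a ↔ x = π a := ⟨fun e => by rw [← e, h.invol], fun e => by rw [e, h.invol]⟩
    have e2 : π x = π a ↔ x = a :=
      ⟨fun e => by rw [← h.invol x, e, h.invol], fun e => by rw [e]⟩
    simp only [mem_insert, mem_erase, ne_eq, e1, e2]
    by_cases c1 : x = a
    · subst c1
      simp [hab.ne, hab.ne']
    by_cases c2 : x = π a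
    · subst c2
      simp [hab.ne, hab.ne', h.invol]
    simpa [c1, c2] using hx'
  have hcard := h.two_mul_card_interior hb hS
  rw [cupVec_of_transversal hS, cupVec_of_transversal hS',
    prod_insert (fun hc => hbS (mem_of_mem_erase hc)), ← mul_prod_erase _ _ ha, ← mul_assoc]
  congr 1
  have hd1 : Nat.dist a (π a) / 2 = #{x ∈ Ioo a (π a) | x ∈ S} := by
    rw [Nat.dist_eq_sub_of_le hab.le]; omega
  have hd2 : Nat.dist (π a) a / 2 = #{x ∈ Ioo a (π a) | x ∈ S} := by rw [Nat.dist_comm, hd1]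
  have hodd := h.odd_sub hb hab
  rw [Nat.odd_sub hab.le] at hodd
  simp only [arcSign, h.invol, hd1, hd2]
  by_cases c : Odd a
  · have : ¬ Odd (π a) := by rw [hodd]; simpa using c
    rw [if_pos c, if_neg this, ← pow_add, ← two_mul, pow_mul]
    simp
  · have : Odd (π a) := by rw [hodd]; simpa using c
    rw [if_pos this, if_neg c, mul_one]

/-- A sign-reversing involution: flip the choice of endpoint on a shortest arc with both endpoints
in `T`. -/
theorem altSum_cupVec (h : IsCups M n π) {T : Finset ℕ} (hT : T ⊆ range M) (hn : n < #T) :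
    altSum K n T (cupVec K M π) = 0 := by
  classical
  rw [altSum_apply]
  by_cases hex : ∃ S ∈ T.powersetCard n, IsTransversal M π S
  swap
  · refine sum_eq_zero fun S hS => ?_
    rw [cupVec_of_not_transversal fun hc => hex ⟨S, hS, hc⟩, mul_zero]
  -- A transversal `S ⊆ T` with `n < #T` misses some point of `T`. This point is matched and its
  -- partner lies in `S`, so arcs within `T` exist.
  obtain ⟨a, haT, hab, hbT, hmin⟩ : ∃ a ∈ T, a < π a ∧ π a ∈ T ∧
      ∀ x ∈ T, x < π x → π x ∈ T → π a - a ≤ π x - x := by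
    obtain ⟨S, hS, htr⟩ := hex
    rw [mem_powersetCard] at hS
    have hne : ({x ∈ T | x < π x ∧ π x ∈ T} : Finset ℕ).Nonempty := by
      obtain ⟨x, hxT, hxS⟩ := exists_mem_notMem_of_card_lt_card (hS.2.symm ▸ hn : #S < #T)
      have hx := htr x (mem_range.1 (hT hxT))
      have hne : π x ≠ x := fun hc => hxS (hx.1 hc)
      have hpx : π x ∈ T := hS.1 ((hx.2 hne).2 hxS)
      rcases lt_or_gt_of_ne hne with hlt | hlt
      · exact ⟨π x, by simp [h.invol, hpx, hlt, hxT]⟩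
      · exact ⟨x, by simp [hpx, hlt, hxT]⟩
    obtain ⟨a, ha, hmin⟩ := exists_min_image _ (fun x => π x - x) hne
    simp only [mem_filter] at ha hmin
    exact ⟨a, ha.1, ha.2.1, ha.2.2, fun x h1 h2 h3 => hmin x ⟨h1, h2, h3⟩⟩
  have hb : π a < M := mem_range.1 (hT hbT)
  have pair : ∀ S ⊆ T, IsTransversal M π S → a ∈ S →
      (-1 : K) ^ rankSum T S * cupVec K M π S +
        (-1) ^ rankSum T (insert (π a) (S.erase a)) *
          cupVec K M π (insert (π a) (S.erase a)) = 0 := by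
    intro S hST hS ha
    have hbS : π a ∉ S := fun hc => (((hS a (hab.trans hb)).2 hab.ne').1 hc) ha
    -- A point of `T` below the arc but outside `S` would have its partner in `S ⊆ T`, giving a
    -- shorter arc within `T`.
    have hint : ∀ x ∈ Ioo a (π a), x ∈ T ↔ x ∈ S := by
      intro x hx
      refine ⟨fun hxT => ?_, fun hxS => hST hxS⟩
      by_contra hxS
      rw [mem_Ioo] at hx
      have hne := h.nest a x hx.1 hx.2
      have hpx : π x ∈ T := hST (((hS x (hx.2.trans hb)).2 hne.2.2).2 hxS)
      rcases lt_or_gt_of_ne hne.2.2 with hlt | hlt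
      · have := hmin (π x) hpx (by rwa [h.invol]) (by rwa [h.invol])
        rw [h.invol] at this
        omega
      · have := hmin x hxT hlt hpx
        omega
    -- The rank grows by one more than the number of interior points of `S`. The latter number is
    -- the exponent of the sign in `cupVec_flip`, so a single minus sign remains.
    have hrank : rankSum T (insert (π a) (S.erase a)) =
        rankSum T S + 1 + #{x ∈ Ioo a (π a) | x ∈ S} := by
      rw [rankSum, rankSum, sum_insert (fun hc => hbS (mem_of_mem_erase hc)),
        ← add_sum_erase _ _ ha]
      have : #{t ∈ T | t < π a} = #{t ∈ T | t < a} + 1 + #{x ∈ Ioo a (π a) | x ∈ S} := by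
        rw [← filter_congr hint, ← card_insert_of_notMem (s := {t ∈ T | t < a}) (a := a) (by simp),
          ← card_union_of_disjoint]
        · congr 1
          ext x
          simp only [mem_filter, mem_union, mem_insert, mem_Ioo]
          constructor
          · intro hx
            rcases lt_trichotomy x a with hlt | rfl | hlt <;> tauto
          · rintro ((rfl | hx) | hx)
            · exact ⟨haT, hab⟩
            · exact ⟨hx.1, hx.2.trans hab⟩
            · exact ⟨hx.2, hx.1.2⟩
        · rw [disjoint_left]
          simp only [mem_filter, mem_insert, mem_Ioo]
          omega
      omega
    rw [h.cupVec_flip hb hab hS ha, hrank, pow_add, pow_add, pow_one]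
    have : ((-1 : K) ^ #{x ∈ Ioo a (π a) | x ∈ S}) * (-1) ^ #{x ∈ Ioo a (π a) | x ∈ S} = 1 := by
      rw [← pow_add, ← two_mul, pow_mul]; simp
    linear_combination (-(-1) ^ rankSum T S * cupVec K M π S) * this
  have hflip : ∀ S, IsTransversal M π S → a ∉ S →
      IsTransversal M π (insert a (S.erase (π a))) := by
    intro S hS ha x hx
    have hx' := hS x hx
    have e1 : π x = a ↔ x = π a := ⟨fun e => by rw [← e, h.invol], fun e => by rw [e, h.invol]⟩
    have e2 : π x = π a ↔ x = a :=
      ⟨fun e => by rw [← h.invol x, e, h.invol], fun e => by rw [e]⟩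
    simp only [mem_insert, mem_erase, ne_eq, e1, e2]
    by_cases c1 : x = a
    · subst c1
      simp [hab.ne, hab.ne']
    by_cases c2 : x = π a
    · subst c2
      simp [hab.ne, hab.ne', h.invol]
    simpa [c1, c2] using hx'
  have hflip' : ∀ S, IsTransversal M π S → a ∈ S →
      IsTransversal M π (insert (π a) (S.erase a)) := by
    intro S hS ha
    by_contra hc
    have h1 := h.cupVec_flip (K := K) hb hab hS ha
    rw [cupVec_of_not_transversal hc] at h1
    exact mul_ne_zero (by simp) (cupVec_ne_zero hS) h1.symm
  have hmem : ∀ S, IsTransversal M π S → (π a ∈ S ↔ a ∉ S) := fun S hS =>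
    (hS a (hab.trans hb)).2 hab.ne'
  rw [← sum_filter_of_ne (p := IsTransversal M π)]
  swap
  · intro S _ hne
    by_contra hc
    exact hne (by rw [cupVec_of_not_transversal hc, mul_zero])
  have hback : ∀ S : Finset ℕ, a ∉ S → π a ∈ S →
      insert (π a) ((insert a (S.erase (π a))).erase a) = S := by
    intro S h1 h2
    rw [erase_insert (by simp [h1]), insert_erase h2]
  have hback' : ∀ S : Finset ℕ, a ∈ S → π a ∉ S →
      insert a ((insert (π a) (S.erase a)).erase (π a)) = S := by
    intro S h1 h2
    rw [erase_insert (by simp [h2]), insert_erase h1]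
  refine sum_involution (fun (S : Finset ℕ) _ => if a ∈ S then insert (π a) (S.erase a)
    else insert a (S.erase (π a))) ?_ ?_ ?_ ?_
  · intro S hS
    simp only [mem_filter, mem_powersetCard] at hS
    split_ifs with ha
    · exact pair S hS.1.1 hS.2 ha
    · have hbS := (hmem S hS.2).2 ha
      have := pair (insert a (S.erase (π a))) (insert_subset haT ((erase_subset _ _).trans hS.1.1))
        (hflip S hS.2 ha) (mem_insert_self _ _)
      rw [hback S ha hbS] at this
      rwa [add_comm]
  · intro S hS _
    simp only [mem_filter, mem_powersetCard] at hS
    split_ifs with ha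
    · intro e
      exact (hmem S hS.2).1 (e ▸ mem_insert_self _ _) ha
    · intro e
      exact ha (e ▸ mem_insert_self _ _)
  · intro S hS
    simp only [mem_filter, mem_powersetCard] at hS ⊢
    split_ifs with ha
    · have hbS : π a ∉ S := fun hc => (hmem S hS.2).1 hc ha
      refine ⟨⟨insert_subset hbT ((erase_subset _ _).trans hS.1.1), ?_⟩, hflip' S hS.2 ha⟩
      rw [card_insert_of_notMem (by simp [hbS]), card_erase_add_one ha, hS.1.2]
    · have hbS := (hmem S hS.2).2 ha
      refine ⟨⟨insert_subset haT ((erase_subset _ _).trans hS.1.1), ?_⟩, hflip S hS.2 ha⟩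
      rw [card_insert_of_notMem (by simp [ha]), card_erase_add_one hbS, hS.1.2]
  · intro S hS
    simp only [mem_filter, mem_powersetCard] at hS
    by_cases ha : a ∈ S
    · have hbS : π a ∉ S := fun hc => (hmem S hS.2).1 hc ha
      have : a ∉ insert (π a) (S.erase a) := by simp [hab.ne]
      rw [if_pos ha, if_neg this, hback' S ha hbS]
    · have hbS := (hmem S hS.2).2 ha
      rw [if_neg ha, if_pos (mem_insert_self _ _), hback S ha hbS]

end IsCups

end Cups

/-! ### Vectors of partial matchings exhaust the kernel of the alternating sums -/

section CupSpan

open Finset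

variable {K : Type*} [Field K]

namespace IsCups

variable {M n : ℕ} {π : ℕ → ℕ}

theorem filter_insert_last (h : IsCups M n π) :
    #{x ∈ range (M + 1) | x ≤ π x} = n + 1 := by
  rw [range_add_one, filter_insert, if_pos (h.fix M le_rfl).ge, card_insert_of_notMem (by simp),
    h.card]

/-- Adding an unmatched point at the end. -/
theorem addFixed (h : IsCups M n π) : IsCups (M + 1) (n + 1) π :=
  ⟨h.invol, fun x hx => h.fix x (by omega), h.nest, h.filter_insert_last⟩

theorem cupVec_addFixed (h : IsCups M n π) {S : Finset ℕ} (hS : S ⊆ range M) :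
    cupVec K (M + 1) π (insert M S) = cupVec K M π S := by
  have hM : M ∉ S := fun h => by simpa using hS h
  have hfix := h.fix M le_rfl
  have : IsTransversal (M + 1) π (insert M S) ↔ IsTransversal M π S := by
    constructor
    · intro ht x hx
      have := ht x (by omega)
      have hx' := h.lt hx
      simpa [hx.ne, hx'.ne] using this
    · intro ht x hx
      by_cases c : x = M
      · subst c
        simp [hfix]
      · have hx1 : x < M := by omega
        have := ht x hx1
        have hx' := h.lt hx1
        simpa [hx1.ne, hx'.ne] using this
  by_cases ht : IsTransversal M π S
  · rw [cupVec_of_transversal ht, cupVec_of_transversal (this.2 ht), prod_insert hM,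
      arcSign_of_fixed hfix, one_mul]
  · rw [cupVec_of_not_transversal ht, cupVec_of_not_transversal (fun hc => ht (this.1 hc))]

theorem cupVec_addFixed_of_subset (h : IsCups M n π) {S : Finset ℕ} (hS : S ⊆ range M) :
    cupVec K (M + 1) π S = 0 := by
  refine cupVec_of_not_transversal fun ht => ?_
  simpa using hS ((ht M (by omega)).1 (h.fix M le_rfl))

theorem exists_last_fixed (h : IsCups M n π) (hM : M < 2 * n) :
    ∃ d < M, π d = d ∧ ∀ x, d < x → x < M → π x ≠ x := by
  have hne : ({x ∈ range M | π x = x} : Finset ℕ).Nonempty := by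
    by_contra hc
    rw [not_nonempty_iff_eq_empty, filter_eq_empty_iff] at hc
    have h1 : #{x ∈ range M | x ≤ π x} ≤ #{x ∈ range M | ¬ x ≤ π x} := by
      refine card_le_card_of_injOn π ?_ fun x _ y _ e => by rw [← h.invol x, e, h.invol]
      intro x hx
      simp only [coe_filter, mem_range, Set.mem_ofPred_eq, h.invol] at hx ⊢
      have := hc (mem_range.2 hx.1)
      exact ⟨h.lt hx.1, by omega⟩
    have h2 := card_filter_add_card_filter_not (s := range M) (fun x => x ≤ π x)
    rw [card_range] at h2
    rw [h.card] at h1 h2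
    omega
  obtain ⟨d, hd, hmax⟩ := exists_max_image _ id hne
  rw [mem_filter, mem_range] at hd
  refine ⟨d, hd.1, hd.2, fun x hx hxM hc => not_le.2 hx (hmax x ?_)⟩
  exact mem_filter.2 ⟨mem_range.2 hxM, hc⟩

/-- Joining the last unmatched point to a new point. -/
theorem exists_join (h : IsCups M n π) (hM : M < 2 * n) : ∃ π' : ℕ → ℕ, IsCups (M + 1) n π' ∧
    ∃ c : K, ∀ S ⊆ range M, cupVec K M π S = c * cupVec K (M + 1) π' S := by
  obtain ⟨d, hd, hfix, hlast⟩ := h.exists_last_fixed hM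
  -- Joining the last unmatched point `d` to `M` creates no crossing and covers no unmatched point.
  -- On sets avoiding `M` the new arc forces `d` into the set, just as being unmatched did, so only
  -- the sign at `d` changes.
  have hMfix := h.fix M le_rfl
  let π' : ℕ → ℕ := fun x => if x = d then M else if x = M then d else π x
  have e1 : π' d = M := if_pos rfl
  have e2 : π' M = d := by simp [π', hd.ne']
  have e3 : ∀ x, x ≠ d → x ≠ M → π' x = π x := fun x h1 h2 => by simp [π', h1, h2]
  have e4 : ∀ x, x ≠ d → π x ≠ d := fun x hx hc => hx (by rw [← h.invol x, hc, hfix])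
  have e5 : ∀ x, x ≠ M → π x ≠ M := fun x hx hc => hx (by rw [← h.invol x, hc, hMfix])
  have hcups : IsCups (M + 1) n π' := by
    refine ⟨fun x => ?_, fun x hx => ?_, fun x y hxy hy => ?_, ?_⟩
    · by_cases c1 : x = d
      · rw [c1, e1, e2]
      by_cases c2 : x = M
      · rw [c2, e2, e1]
      rw [e3 x c1 c2, e3 _ (e4 x c1) (e5 x c2), h.invol]
    · rw [e3 x (by omega) (by omega), h.fix x (by omega)]
    · by_cases c1 : x = d
      · rw [c1, e1] at hy
        rw [c1] at hxy
        rw [c1, e1, e3 y (by omega) (by omega)]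
        have h1 := hlast y hxy hy
        refine ⟨?_, h.lt hy, h1⟩
        by_contra hc
        have h2 := e4 y (by omega)
        have h3 := h.nest (π y) d (by omega) (by rwa [h.invol])
        exact h3.2.2 hfix
      by_cases c2 : x = M
      · rw [c2, e2] at hy
        omega
      rw [e3 x c1 c2] at hy ⊢
      have hn := h.nest x y hxy hy
      have hxM : x < M := by
        by_contra hc
        rw [h.fix x (by omega)] at hy
        omega
      have hyM := hy.trans (h.lt hxM)
      have hyd : y ≠ d := fun hc => hn.2.2 (by rw [hc, hfix])
      rwa [e3 y hyd hyM.ne]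
    · rw [range_add_one, filter_insert, if_neg (by omega), ← h.card]
      congr 1
      refine filter_congr fun x hx => ?_
      rw [mem_range] at hx
      by_cases c1 : x = d
      · rw [c1, e1, hfix]
        omega
      · rw [e3 x c1 hx.ne]
  refine ⟨π', hcups, arcSign K π' d, fun S hS => ?_⟩
  have hMS : M ∉ S := fun h => by simpa using hS h
  have htr : IsTransversal (M + 1) π' S ↔ IsTransversal M π S := by
    constructor
    · intro ht x hx
      by_cases c : x = d
      · subst c
        have := (ht x (by omega)).2 (by omega)
        rw [e1] at this
        exact ⟨fun _ => by tauto, fun hc => absurd hfix hc⟩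
      · have := ht x (by omega)
        rwa [e3 x c hx.ne] at this
    · intro ht x hx
      have hdS := (ht d hd).1 hfix
      by_cases c : x = d
      · subst c
        rw [e1]
        exact ⟨fun _ => hdS, fun _ => by tauto⟩
      by_cases c2 : x = M
      · subst c2
        rw [e2]
        exact ⟨fun _ => by omega, fun _ => by tauto⟩
      rw [e3 x c c2]
      exact ht x (by omega)
  by_cases ht : IsTransversal M π S
  · have hdS := (ht d hd).1 hfix
    rw [cupVec_of_transversal ht, cupVec_of_transversal (htr.2 ht), ← mul_prod_erase S _ hdS,
      ← mul_prod_erase S (arcSign K π') hdS, arcSign_of_fixed hfix, one_mul, ← mul_assoc]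
    have hsq : arcSign K π' d * arcSign K π' d = 1 := by
      unfold arcSign
      split_ifs
      · rw [← pow_add, ← two_mul, pow_mul]; simp
      · simp
    rw [hsq, one_mul]
    refine prod_congr rfl fun x hx => ?_
    rw [mem_erase] at hx
    unfold arcSign
    rw [e3 x hx.1 (fun hc => hMS (hc ▸ hx.2))]
  · rw [cupVec_of_not_transversal ht, cupVec_of_not_transversal (fun hc => ht (htr.1 hc)), mul_zero]

end IsCups

variable (K) in
/-- The span of the vectors attached to partial matchings. -/
def cupSpan (M n : ℕ) : Submodule K (Finset ℕ → K) :=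
  Submodule.span K {u | ∃ π, IsCups M n π ∧ u = cupVec K M π}

theorem altSum_cupSpan {M n : ℕ} {u : Finset ℕ → K} (hu : u ∈ cupSpan K M n) {T : Finset ℕ}
    (hT : T ⊆ range M) (hn : n < #T) : altSum K n T u = 0 := by
  have : cupSpan K M n ≤ LinearMap.ker (altSum K n T) := by
    rw [cupSpan, Submodule.span_le]
    rintro _ ⟨π, h, rfl⟩
    exact h.altSum_cupVec hT hn
  exact this hu

theorem exists_cupSpan_join {M n : ℕ} (hM : M < 2 * n) {u : Finset ℕ → K}
    (hu : u ∈ cupSpan K M n) : ∃ w ∈ cupSpan K (M + 1) n, ∀ S ⊆ range M, u S = w S := by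
  induction hu using Submodule.span_induction with
  | mem u hu =>
    obtain ⟨π, h, rfl⟩ := hu
    obtain ⟨π', h', c, hc⟩ := h.exists_join (K := K) hM
    exact ⟨c • cupVec K (M + 1) π', Submodule.smul_mem _ _ (Submodule.subset_span ⟨π', h', rfl⟩),
      hc⟩
  | zero => exact ⟨0, Submodule.zero_mem _, fun _ _ => rfl⟩
  | add u v _ _ h1 h2 =>
    obtain ⟨w1, hw1, e1⟩ := h1
    obtain ⟨w2, hw2, e2⟩ := h2
    exact ⟨w1 + w2, Submodule.add_mem _ hw1 hw2, fun S hS => by simp [e1 S hS, e2 S hS]⟩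
  | smul a u _ h1 =>
    obtain ⟨w1, hw1, e1⟩ := h1
    exact ⟨a • w1, Submodule.smul_mem _ _ hw1, fun S hS => by simp [e1 S hS]⟩

theorem exists_cupSpan_addFixed {M n : ℕ} {u : Finset ℕ → K} (hu : u ∈ cupSpan K M n) :
    ∃ w ∈ cupSpan K (M + 1) (n + 1), ∀ S ⊆ range M, w (insert M S) = u S ∧ w S = 0 := by
  induction hu using Submodule.span_induction with
  | mem u hu =>
    obtain ⟨π, h, rfl⟩ := hu
    exact ⟨_, Submodule.subset_span ⟨π, h.addFixed, rfl⟩, fun S hS =>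
      ⟨h.cupVec_addFixed hS, h.cupVec_addFixed_of_subset hS⟩⟩
  | zero => exact ⟨0, Submodule.zero_mem _, fun _ _ => ⟨rfl, rfl⟩⟩
  | add u v _ _ h1 h2 =>
    obtain ⟨w1, hw1, e1⟩ := h1
    obtain ⟨w2, hw2, e2⟩ := h2
    exact ⟨w1 + w2, Submodule.add_mem _ hw1 hw2, fun S hS => by simp [e1 S hS, e2 S hS]⟩
  | smul a u _ h1 =>
    obtain ⟨w1, hw1, e1⟩ := h1
    exact ⟨a • w1, Submodule.smul_mem _ _ hw1, fun S hS => by simp [e1 S hS]⟩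

/-- The vectors attached to partial matchings span the common kernel of the alternating sums. -/
theorem exists_mem_cupSpan (M : ℕ) : ∀ (n : ℕ) (u : Finset ℕ → K),
    (∀ T ⊆ range M, n < #T → altSum K n T u = 0) →
      ∃ w ∈ cupSpan K M n, ∀ S ⊆ range M, #S = n → u S = w S := by
  induction M with
  | zero =>
    intro n u _
    by_cases hn : n = 0
    · have h : IsCups 0 n id := ⟨fun _ => rfl, fun _ _ => rfl, fun x y h1 h2 => by
        simp only [id] at h2; omega, by simp [hn]⟩
      refine ⟨u ∅ • cupVec K 0 id, Submodule.smul_mem _ _ (Submodule.subset_span ⟨_, h, rfl⟩), ?_⟩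
      intro S hS _
      obtain rfl : S = ∅ := by simpa using hS
      rw [Pi.smul_apply, cupVec_of_transversal (fun x hx => by omega)]
      simp
    · refine ⟨0, Submodule.zero_mem _, fun S hS hc => ?_⟩
      obtain rfl : S = ∅ := by simpa using hS
      exact absurd hc.symm hn
  | succ M ih =>
    intro n u hu
    -- Beyond the middle the kernel is zero on `n`-subsets. Otherwise the part of `u` on sets
    -- avoiding `M` is lifted by joining, and the remainder lives on sets containing `M`, where an
    -- unmatched point is added.
    by_cases hlt : 2 * n < M + 1
    · exact ⟨0, Submodule.zero_mem _, fun S hS hc =>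
        eq_zero_of_altSum_eq_zero (M + 1) n 1 u hlt (fun T hT h => hu T hT h) S hS hc⟩
    obtain _ | n := n
    · omega
    obtain ⟨w0, hw0, e0⟩ := ih (n + 1) u fun T hT h => hu T (hT.trans (range_mono (by omega))) h
    obtain ⟨w1, hw1, e1⟩ := exists_cupSpan_join (by omega) hw0
    have hz : ∀ S ⊆ range M, #S = n + 1 → (u - w1) S = 0 := fun S hS hc => by
      rw [Pi.sub_apply, e0 S hS hc, e1 S hS, sub_self]
    obtain ⟨w2, hw2, e2⟩ := ih n (fun S => (u - w1) (insert M S)) fun T hT h => by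
      have h3 : n + 1 < #(insert M T) := by rw [card_insert_of_subset_range hT]; omega
      have hT' := insert_subset_range_succ hT
      have h4 : altSum K (n + 1) (insert M T) (u - w1) = 0 := by
        rw [map_sub, hu _ hT' h3, altSum_cupSpan hw1 hT' h3, sub_zero]
      rw [altSum_insert hT, altSum_eq_zero fun S hS => hz S (hS.trans hT), zero_add] at h4
      simpa using h4
    obtain ⟨w3, hw3, e3⟩ := exists_cupSpan_addFixed hw2
    refine ⟨w1 + w3, Submodule.add_mem _ hw1 hw3, fun S hS hc => ?_⟩
    rw [Pi.add_apply]
    obtain h | ⟨S', h, hc', rfl⟩ := subset_range_succ_cases hS hc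
    · rw [(e3 S h).2, add_zero]
      exact sub_eq_zero.1 (hz S h hc)
    · rw [(e3 S' h).1, ← e2 S' h (by omega)]
      simp

end CupSpan

namespace TLDiagram

open Finset

variable {K : Type*} [Field K] {n : ℕ}

/-! ### Diagrams as involutions of the natural numbers -/

/-- The involution of the natural numbers given by a diagram. -/
def arc (D : TLDiagram n) (x : ℕ) : ℕ := if h : x < 2 * n then D.partner ⟨x, h⟩ else x

theorem arc_of_lt (D : TLDiagram n) {x : ℕ} (h : x < 2 * n) : D.arc x = D.partner ⟨x, h⟩ :=
  dif_pos h

theorem arc_val (D : TLDiagram n) (x : Fin (2 * n)) : D.arc x = D.partner x :=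
  D.arc_of_lt x.isLt

theorem arc_of_le (D : TLDiagram n) {x : ℕ} (h : 2 * n ≤ x) : D.arc x = x :=
  dif_neg (not_lt.2 h)

theorem arc_lt (D : TLDiagram n) {x : ℕ} (h : x < 2 * n) : D.arc x < 2 * n := by
  rw [D.arc_of_lt h]
  exact Fin.isLt _

theorem arc_arc (D : TLDiagram n) (x : ℕ) : D.arc (D.arc x) = x := by
  by_cases h : x < 2 * n
  · rw [D.arc_of_lt h, arc_val, D.partner_partner]
  · rw [D.arc_of_le (not_lt.1 h), D.arc_of_le (not_lt.1 h)]

theorem arc_ne (D : TLDiagram n) {x : ℕ} (h : x < 2 * n) : D.arc x ≠ x := by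
  rw [D.arc_of_lt h]
  exact fun hc => D.partner_ne _ (Fin.ext hc)

theorem arc_inj (D : TLDiagram n) {x y : ℕ} (h : D.arc x = D.arc y) : x = y := by
  rw [← D.arc_arc x, h, D.arc_arc]

theorem arc_eq_comm (D : TLDiagram n) {x y : ℕ} : D.arc x = y ↔ x = D.arc y :=
  ⟨fun h => by rw [← h, arc_arc], fun h => by rw [h, arc_arc]⟩

theorem arc_noncrossing (D : TLDiagram n) {x y : ℕ} (hx : x < 2 * n) (hy : y < 2 * n) :
    ¬ (x < y ∧ y < D.arc x ∧ D.arc x < D.arc y) := by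
  rw [D.arc_of_lt hx, D.arc_of_lt hy]
  exact D.noncrossing ⟨x, hx⟩ ⟨y, hy⟩

theorem arc_injective : Function.Injective (arc : TLDiagram n → ℕ → ℕ) := by
  intro D D' h
  refine TLDiagram.ext (funext fun x => Fin.ext ?_)
  rw [← arc_val, ← arc_val, h]

theorem card_openers (D : TLDiagram n) : #{x ∈ range (2 * n) | x ≤ D.arc x} = n := by
  have h1 : #{x ∈ range (2 * n) | x ≤ D.arc x} = #{x ∈ range (2 * n) | ¬ x ≤ D.arc x} := by
    refine card_nbij' D.arc D.arc ?_ ?_ (fun x _ => D.arc_arc x) (fun x _ => D.arc_arc x)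
    · intro x hx
      simp only [coe_filter, mem_range, Set.mem_ofPred_eq, arc_arc] at hx ⊢
      have := D.arc_ne hx.1
      exact ⟨D.arc_lt hx.1, by omega⟩
    · intro x hx
      simp only [coe_filter, mem_range, Set.mem_ofPred_eq, arc_arc] at hx ⊢
      exact ⟨D.arc_lt hx.1, by omega⟩
  have h2 := card_filter_add_card_filter_not (s := range (2 * n)) (fun x => x ≤ D.arc x)
  rw [card_range] at h2
  omega

theorem isCups (D : TLDiagram n) : IsCups (2 * n) n D.arc := by
  refine ⟨D.arc_arc, fun x => D.arc_of_le, fun x y hxy hy => ?_, D.card_openers⟩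
  have hx : x < 2 * n := by
    by_contra hc
    rw [D.arc_of_le (not_lt.1 hc)] at hy
    omega
  have hy' := hy.trans (D.arc_lt hx)
  have h1 := D.arc_noncrossing hx hy'
  have h2 := D.arc_noncrossing (D.arc_lt hy') hx
  have h3 := D.arc_ne hy'
  have h4 : D.arc y ≠ D.arc x := fun hc => by have := D.arc_inj hc; omega
  have h5 : D.arc y ≠ x := fun hc => by rw [← hc, arc_arc] at hy; omega
  rw [arc_arc] at h2
  omega

/-- The diagram given by a function on the natural numbers. -/
def ofArc (π : ℕ → ℕ) (hlt : ∀ x < 2 * n, π x < 2 * n) (hinv : ∀ x < 2 * n, π (π x) = x)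
    (hne : ∀ x < 2 * n, π x ≠ x)
    (hnc : ∀ x < 2 * n, ∀ y < 2 * n, ¬ (x < y ∧ y < π x ∧ π x < π y)) : TLDiagram n where
  partner x := ⟨π x, hlt x x.isLt⟩
  partner_partner x := Fin.ext (hinv x x.isLt)
  partner_ne x h := hne x x.isLt (congrArg Fin.val h)
  noncrossing x y h := hnc x x.isLt y y.isLt h

theorem arc_ofArc {π : ℕ → ℕ} {hlt hinv hne hnc} {x : ℕ} (hx : x < 2 * n) :
    (ofArc (n := n) π hlt hinv hne hnc).arc x = π x := by
  rw [arc_of_lt _ hx]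
  rfl

/-- With `2 * n` points, the `n` right endpoints need `n` left endpoints, which leaves no room for
unmatched points. -/
theorem exists_arc_eq {π : ℕ → ℕ} (h : IsCups (2 * n) n π) : ∃ D : TLDiagram n, D.arc = π := by
  have hne : ∀ x < 2 * n, π x ≠ x := by
    have h1 : #{x ∈ range (2 * n) | ¬ x ≤ π x} ≤ #{x ∈ range (2 * n) | x < π x} := by
      refine card_le_card_of_injOn π ?_ fun x _ y _ e => by rw [← h.invol x, e, h.invol]
      intro x hx
      simp only [coe_filter, mem_range, Set.mem_ofPred_eq, h.invol] at hx ⊢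
      exact ⟨h.lt hx.1, by omega⟩
    have h2 := card_filter_add_card_filter_not (s := range (2 * n)) (fun x => x ≤ π x)
    rw [h.card, card_range] at h2
    intro x hx hc
    have h3 : #{x ∈ range (2 * n) | x < π x} < #{x ∈ range (2 * n) | x ≤ π x} := by
      refine card_lt_card ((ssubset_iff_of_subset ?_).2 ⟨x, ?_, ?_⟩)
      · exact monotone_filter_right _ fun y _ hy => le_of_lt hy
      · simp [hx, hc]
      · simp [hc]
    rw [h.card] at h3
    omega
  refine ⟨ofArc π (fun x hx => h.lt hx) (fun x _ => h.invol x) hne fun x _ y _ hc => ?_, ?_⟩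
  · have := h.nest x y hc.1 hc.2.1
    omega
  · funext x
    by_cases hx : x < 2 * n
    · rw [arc_ofArc hx]
    · rw [arc_of_le _ (not_lt.1 hx), h.fix x (not_lt.1 hx)]

theorem odd_arc (D : TLDiagram n) {x : ℕ} (hx : x < 2 * n) : Odd (D.arc x) ↔ ¬ Odd x := by
  rcases lt_or_gt_of_ne (D.arc_ne hx) with h | h
  · have := D.isCups.odd_sub (a := D.arc x) (by rwa [arc_arc]) (by rwa [arc_arc])
    rw [arc_arc] at this
    simp only [Nat.odd_iff] at this ⊢
    omega
  · have := D.isCups.odd_sub (D.arc_lt hx) h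
    simp only [Nat.odd_iff] at this ⊢
    omega

/-! ### Surgery -/

/-- The involution obtained by joining `a` to `a + 1`, and the former partners of these points to
each other. -/
def surgArc (π : ℕ → ℕ) (a x : ℕ) : ℕ :=
  if x = a then a + 1 else if x = a + 1 then a else
    if x = π a then π (a + 1) else if x = π (a + 1) then π a else π x

/-- The diagram obtained by joining the point `a` to `a + 1`, and the former partners of these
points to each other. -/
def surg (D : TLDiagram n) (a : ℕ) (ha : a + 1 < 2 * n) : TLDiagram n :=
  ofArc (surgArc D.arc a)
    (fun x hx => by
      have h1 := D.arc_lt hx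
      have h2 := D.arc_lt ha
      have h3 := D.arc_lt (show a < 2 * n by omega)
      unfold surgArc
      split_ifs <;> omega)
    (fun x hx => by
      have e1 : ∀ y, D.arc x = y ↔ x = D.arc y := fun y => D.arc_eq_comm
      have e2 : D.arc a = D.arc (a + 1) ↔ False :=
        ⟨fun h => by have := D.arc_inj h; omega, False.elim⟩
      have h2 := D.arc_ne ha
      have h3 := D.arc_ne (show a < 2 * n by omega)
      have e3 : D.arc (a + 1) = a ↔ a + 1 = D.arc a := D.arc_eq_comm
      by_cases c1 : x = a
      · simp [surgArc, c1]
      by_cases c2 : x = a + 1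
      · simp [surgArc, c2]
      by_cases c3 : x = D.arc a
      · have : D.arc (a + 1) ≠ a := by rw [ne_eq, e3, ← c3]; omega
        simp [surgArc, c1, c2, ← c3, this, h2]
      by_cases c4 : x = D.arc (a + 1)
      · have : D.arc a ≠ a + 1 := by rw [ne_eq, ← D.arc_eq_comm.trans eq_comm, ← c4]; omega
        simp [surgArc, c1, c2, c3, ← c4, this, h3]
      have d1 : D.arc x ≠ a := by rwa [ne_eq, e1]
      have d2 : D.arc x ≠ a + 1 := by rwa [ne_eq, e1]
      have d3 : D.arc x ≠ D.arc a := fun h => c1 (D.arc_inj h)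
      have d4 : D.arc x ≠ D.arc (a + 1) := fun h => c2 (D.arc_inj h)
      simp [surgArc, c1, c2, c3, c4, d1, d2, d3, d4, arc_arc])
    (fun x hx => by
      have h1 := D.arc_ne hx
      have e2 : D.arc a ≠ D.arc (a + 1) := fun h => by have := D.arc_inj h; omega
      unfold surgArc
      split_ifs <;> omega)
    (fun x hx y hy => by
      have hnc := D.arc_noncrossing hx hy
      have na := D.isCups.nest x a
      have na' := D.isCups.nest x (a + 1)
      have nb := D.isCups.nest x (D.arc a)
      have nb' := D.isCups.nest x (D.arc (a + 1))
      have ma := D.isCups.nest y a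
      have ma' := D.isCups.nest y (a + 1)
      have mb := D.isCups.nest y (D.arc a)
      have mb' := D.isCups.nest y (D.arc (a + 1))
      have e1 : D.arc x = a + 1 ↔ x = D.arc (a + 1) := D.arc_eq_comm
      have e2 : D.arc y = a + 1 ↔ y = D.arc (a + 1) := D.arc_eq_comm
      rw [arc_arc] at nb nb' mb mb'
      unfold surgArc
      split_ifs <;> omega)

theorem arc_surg (D : TLDiagram n) {a : ℕ} (ha : a + 1 < 2 * n) {x : ℕ} (hx : x < 2 * n) :
    (D.surg a ha).arc x = surgArc D.arc a x := arc_ofArc hx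

end TLDiagram

namespace TLDiagram

open Finset

variable {K : Type*} [Field K] {n : ℕ}

theorem neg_one_pow_eq_of_mod {i j : ℕ} (h : i % 2 = j % 2) : (-1 : K) ^ i = (-1) ^ j := by
  rw [neg_one_pow_eq_pow_mod_two, h, ← neg_one_pow_eq_pow_mod_two]

/-! ### The vectors attached to diagrams -/

theorem transversal_iff (D : TLDiagram n) {S : Finset ℕ} :
    IsTransversal (2 * n) D.arc S ↔ ∀ x < 2 * n, D.arc x ∈ S ↔ x ∉ S :=
  ⟨fun h x hx => (h x hx).2 (D.arc_ne hx),
    fun h x hx => ⟨fun hc => absurd hc (D.arc_ne hx), fun _ => h x hx⟩⟩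

theorem transversal_iff_of_mem (D : TLDiagram n) {a b : ℕ} (ha : a < 2 * n) (hb : b < 2 * n)
    (S : Finset ℕ) : IsTransversal (2 * n) D.arc S ↔
      (∀ x < 2 * n, x ≠ a → x ≠ b → x ≠ D.arc a → x ≠ D.arc b → (D.arc x ∈ S ↔ x ∉ S)) ∧
        (D.arc a ∈ S ↔ a ∉ S) ∧ (D.arc b ∈ S ↔ b ∉ S) := by
  rw [transversal_iff]
  refine ⟨fun h => ⟨fun x hx _ _ _ _ => h x hx, h a ha, h b hb⟩, fun h x hx => ?_⟩
  by_cases c1 : x = a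
  · rw [c1]; exact h.2.1
  by_cases c2 : x = b
  · rw [c2]; exact h.2.2
  by_cases c3 : x = D.arc a
  · rw [c3, arc_arc]
    have := h.2.1
    tauto
  by_cases c4 : x = D.arc b
  · rw [c4, arc_arc]
    have := h.2.2
    tauto
  exact h.1 x hx c1 c2 c3 c4

variable (K) in
/-- Splitting off two points from the product of signs over `S`. -/
theorem prod_arcSign_pair {π π' : ℕ → ℕ} {S : Finset ℕ} {a b : ℕ} (ha : a ∈ S) (hb : b ∈ S)
    (hab : a ≠ b) {S₀ : Finset ℕ} (hS : (S.erase a).erase b = S₀)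
    (h : ∀ x ∈ S₀, π x = π' x) :
    ∏ x ∈ S, arcSign K π x = arcSign K π a * arcSign K π b * ∏ x ∈ S₀, arcSign K π' x := by
  rw [← mul_prod_erase S _ ha, ← mul_prod_erase (S.erase a) _ (mem_erase.2 ⟨hab.symm, hb⟩), hS,
    mul_assoc]
  congr 2
  refine prod_congr rfl fun x hx => ?_
  unfold arcSign
  rw [h x hx]

/-- As the arcs at `a` and `a + 1` do not cross, they either point away from each other or are
nested on one side. All lengths are odd. The half-lengths differ by `1` in the first case and by the
odd length of the shorter arc in the second, modulo `2`. -/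
theorem sign_surg (D : TLDiagram n) {a : ℕ} (ha : a + 1 < 2 * n) (hc : D.arc a ≠ a + 1) :
    (-1 : K) ^ (Nat.dist a (D.arc a) / 2) * (-1) ^ (Nat.dist (a + 1) (D.arc (a + 1)) / 2) =
      -(-1) ^ (Nat.dist (D.arc a) (D.arc (a + 1)) / 2) := by
  have ha0 : a < 2 * n := by omega
  have p1 := D.odd_arc ha0
  have p2 := D.odd_arc ha
  have h0 := D.arc_ne ha0
  have h1 := D.arc_ne ha
  have h2 : D.arc (a + 1) ≠ a := fun h => hc (D.arc_eq_comm.2 h.symm ▸ rfl)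
  have h3 : D.arc a ≠ D.arc (a + 1) := fun h => by have := D.arc_inj h; omega
  have n1 := D.isCups.nest (D.arc a) (a + 1)
  have n2 := D.isCups.nest a (D.arc (a + 1))
  have n3 := D.isCups.nest a (a + 1)
  have n4 := D.isCups.nest (D.arc (a + 1)) a
  rw [arc_arc] at n1 n2 n4
  have hneg : ∀ k, -(-1 : K) ^ k = (-1) ^ (k + 1) := fun k => by rw [pow_succ]; ring
  rw [← pow_add, hneg]
  refine neg_one_pow_eq_of_mod ?_
  simp only [Nat.odd_iff, Nat.dist] at *
  omega

/-- Moving a point of `S` to its right neighbour is a surgery. -/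
theorem cupVec_sub_cupVec (D : TLDiagram n) {a : ℕ} (ha : a + 1 < 2 * n) {S : Finset ℕ}
    (haS : a ∈ S) (haS' : a + 1 ∉ S) (hS : S ⊆ range (2 * n)) :
    cupVec K (2 * n) D.arc S - cupVec K (2 * n) D.arc (insert (a + 1) (S.erase a)) =
      (-1) ^ a * if D.arc a = a + 1 then 0 else cupVec K (2 * n) (D.surg a ha).arc S := by
  classical
  have ha0 : a < 2 * n := by omega
  set S' := insert (a + 1) (S.erase a) with hS'
  have hmem : ∀ x, x ≠ a → x ≠ a + 1 → (x ∈ S' ↔ x ∈ S) := fun x h1 h2 => by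
    simp [hS', h1, h2]
  have ha1 : a ∉ S' := by simp [hS']
  have ha2 : a + 1 ∈ S' := by simp [hS']
  by_cases hc : D.arc a = a + 1
  · rw [if_pos hc, mul_zero, sub_eq_zero]
    by_cases ht : IsTransversal (2 * n) D.arc S
    · have := D.isCups.cupVec_flip (K := K) (a := a) (by rwa [hc]) (by omega) ht haS
      rw [hc, ← hS'] at this
      have hcard := D.isCups.two_mul_card_interior (a := a) (by rwa [hc]) ht
      rw [hc] at hcard
      rw [this, (by omega : #{x ∈ Ioo a (a + 1) | x ∈ S} = 0), pow_zero, one_mul]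
    · rw [cupVec_of_not_transversal ht, cupVec_of_not_transversal]
      refine fun ht' => ht ?_
      rw [transversal_iff] at ht' ⊢
      intro x hx
      by_cases c1 : x = a
      · subst c1; rw [hc]; tauto
      by_cases c2 : x = a + 1
      · subst c2; rw [← hc, arc_arc, hc]; tauto
      have h1 : D.arc x ≠ a := fun h => c2 (by rw [← hc, ← h, arc_arc])
      have h2 : D.arc x ≠ a + 1 := fun h => c1 (by rw [← D.arc_arc x, h, ← hc, arc_arc])
      have := ht' x hx
      rwa [hmem _ h1 h2, hmem _ c1 c2] at this
  rw [if_neg hc]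
  set α := D.arc a with hα
  set β := D.arc (a + 1) with hβ
  have hαa : D.arc α = a := D.arc_arc a
  have hβa : D.arc β = a + 1 := D.arc_arc _
  have hα0 : α ≠ a := D.arc_ne ha0
  have hβ1 : β ≠ a + 1 := D.arc_ne ha
  have hβ0 : β ≠ a := fun h => hc (by rw [hα, ← h, hβa, h])
  have hαβ : α ≠ β := fun h => by have := D.arc_inj h; omega
  have hαn : α < 2 * n := D.arc_lt ha0
  have hβn : β < 2 * n := D.arc_lt ha
  have hE : ∀ x, x < 2 * n → (D.surg a ha).arc x = surgArc D.arc a x := fun x hx =>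
    D.arc_surg ha hx
  have ea : (D.surg a ha).arc a = a + 1 := by rw [hE a ha0]; simp [surgArc]
  have eα : (D.surg a ha).arc α = β := by
    rw [hE α hαn]; simp [surgArc, hα0, hc, ← hα, ← hβ]
  have eβ : (D.surg a ha).arc β = α := by
    rw [hE β hβn]; simp [surgArc, hβ0, hβ1, hαβ.symm, ← hα, ← hβ]
  have eo : ∀ x < 2 * n, x ≠ a → x ≠ a + 1 → x ≠ α → x ≠ β →
      (D.surg a ha).arc x = D.arc x := by
    intro x hx h1 h2 h3 h4
    rw [hE x hx]; simp [surgArc, h1, h2, h3, h4, ← hα, ← hβ]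
  have hR : ∀ x < 2 * n, x ≠ a → x ≠ a + 1 → x ≠ α → x ≠ β → D.arc x ≠ a ∧ D.arc x ≠ a + 1 := by
    intro x _ _ _ h3 h4
    exact ⟨fun h => h3 (by rw [hα, ← h, arc_arc]), fun h => h4 (by rw [hβ, ← h, arc_arc])⟩
  have t1 := D.transversal_iff_of_mem ha0 ha S
  have t2 := D.transversal_iff_of_mem ha0 ha S'
  have t3 := (D.surg a ha).transversal_iff_of_mem ha0 hαn S
  rw [← hα, ← hβ] at t1 t2
  rw [ea, eα] at t3
  set R := ∀ x < 2 * n, x ≠ a → x ≠ a + 1 → x ≠ α → x ≠ β → (D.arc x ∈ S ↔ x ∉ S) with hRdef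
  have r2 : (∀ x < 2 * n, x ≠ a → x ≠ a + 1 → x ≠ α → x ≠ β → (D.arc x ∈ S' ↔ x ∉ S')) ↔ R := by
    refine forall₂_congr fun x hx => forall₄_congr fun h1 h2 h3 h4 => ?_
    have := hR x hx h1 h2 h3 h4
    rw [hmem _ this.1 this.2, hmem _ h1 h2]
  have r3 : (∀ x < 2 * n, x ≠ a → x ≠ α → x ≠ a + 1 → x ≠ β →
      ((D.surg a ha).arc x ∈ S ↔ x ∉ S)) ↔ R := by
    constructor
    · intro h x hx h1 h2 h3 h4
      rw [← eo x hx h1 h2 h3 h4]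
      exact h x hx h1 h3 h2 h4
    · intro h x hx h1 h2 h3 h4
      rw [eo x hx h1 h3 h2 h4]
      exact h x hx h1 h3 h2 h4
  rw [r2, hmem α hα0 hc, hmem β hβ0 hβ1] at t2
  rw [r3] at t3
  simp only [haS, haS', not_true_eq_false, not_false_eq_true, iff_false, iff_true] at t1 t3
  simp only [ha1, ha2, not_true_eq_false, not_false_eq_true, iff_false, iff_true] at t2
  have hsign := D.sign_surg (K := K) ha hc
  rw [← hα, ← hβ] at hsign
  have p1 := D.odd_arc ha0
  have p2 := D.odd_arc ha
  rw [← hα] at p1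
  rw [← hβ] at p2
  have p3 : Odd (a + 1) ↔ ¬ Odd a := by simp only [Nat.odd_iff]; omega
  have sa : arcSign K (D.surg a ha).arc a = 1 := by
    simp [arcSign, ea, Nat.dist_eq_sub_of_le]
  obtain ⟨S₀, hS₀⟩ : ∃ S₀, S₀ = (((S.erase a).erase (a + 1)).erase α).erase β := ⟨_, rfl⟩
  have hS₀eq : ∀ x ∈ S₀, D.arc x = (D.surg a ha).arc x := by
    intro x hx
    simp only [hS₀, mem_erase] at hx
    exact (eo x (mem_range.1 (hS hx.2.2.2.2)) hx.2.2.2.1 hx.2.2.1 hx.2.1 hx.1).symm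
  clear_value R
  by_cases hRR : R
  swap
  · rw [cupVec_of_not_transversal (fun h => hRR (t1.1 h).1),
      cupVec_of_not_transversal (fun h => hRR (t2.1 h).1),
      cupVec_of_not_transversal (fun h => hRR (t3.1 h).1)]
    simp
  -- The surgered diagram requires exactly one of `α`, `β` in `S`. The choice `β` comes from `S` and
  -- the choice `α` from `S'`; in the two other cases all three terms vanish.
  by_cases mα : α ∈ S <;> by_cases mβ : β ∈ S
  · rw [cupVec_of_not_transversal (fun h => by simpa [mα, mβ] using t1.1 h),
      cupVec_of_not_transversal (fun h => by simpa [mα, mβ] using t2.1 h),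
      cupVec_of_not_transversal (fun h => by simpa [mα, mβ] using t3.1 h)]
    simp
  · have s1 : (S'.erase (a + 1)).erase α = S₀ := by
      ext x
      simp only [hS₀, hS', mem_erase, mem_insert]
      constructor
      · rintro ⟨h1, h2, h3⟩
        have h4 := h3.resolve_left h2
        exact ⟨fun h => mβ (h ▸ h4.2), h1, h2, h4.1, h4.2⟩
      · exact fun h => ⟨h.2.1, h.2.2.1, .inr h.2.2.2⟩
    have s3 : (S.erase a).erase α = S₀ := by
      ext x
      simp only [hS₀, mem_erase]
      constructor
      · rintro ⟨h1, h2, h3⟩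
        exact ⟨fun h => mβ (h ▸ h3), h1, fun h => haS' (h ▸ h3), h2, h3⟩
      · exact fun h => ⟨h.2.1, h.2.2.2.1, h.2.2.2.2⟩
    rw [cupVec_of_not_transversal (fun h => by simpa [mα, mβ] using t1.1 h),
      cupVec_of_transversal (t2.2 ⟨hRR, mα, mβ⟩),
      cupVec_of_transversal (t3.2 ⟨hRR, by simp [mα, mβ]⟩),
      prod_arcSign_pair K ha2 ((hmem α hα0 hc).2 mα) (Ne.symm hc) s1 hS₀eq,
      prod_arcSign_pair K haS mα hα0.symm s3 (fun _ _ => rfl), sa, one_mul, zero_sub,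
      ← mul_assoc, ← neg_mul]
    congr 1
    unfold arcSign
    rw [hαa, eα, ← hβ]
    simp only [p1, p3]
    by_cases ho : Odd a
    · simp [ho]
    · simp only [ho, not_false_eq_true, if_true]
      rw [Nat.dist_comm α a, mul_comm, hsign, (Nat.not_odd_iff_even.1 ho).neg_one_pow, neg_neg,
        one_mul]
  · have s1 : (S.erase a).erase β = S₀ := by
      ext x
      simp only [hS₀, mem_erase]
      constructor
      · rintro ⟨h1, h2, h3⟩
        exact ⟨h1, fun h => mα (h ▸ h3), fun h => haS' (h ▸ h3), h2, h3⟩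
      · exact fun h => ⟨h.1, h.2.2.2.1, h.2.2.2.2⟩
    rw [cupVec_of_not_transversal (S := S') (fun h => by simpa [mα, mβ] using t2.1 h),
      cupVec_of_transversal (t1.2 ⟨hRR, mα, mβ⟩),
      cupVec_of_transversal (t3.2 ⟨hRR, by simp [mα, mβ]⟩),
      prod_arcSign_pair K haS mβ hβ0.symm s1 hS₀eq,
      prod_arcSign_pair K haS mβ hβ0.symm s1 (fun _ _ => rfl), sa, one_mul, sub_zero,
      ← mul_assoc]
    congr 1
    unfold arcSign
    rw [hβa, eβ, ← hα]
    simp only [p2, p3, not_not]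
    by_cases ho : Odd a
    · simp only [ho, if_true]
      rw [Nat.dist_comm β (a + 1), hsign, Nat.dist_comm, ho.neg_one_pow, neg_one_mul]
    · simp [ho, (Nat.not_odd_iff_even.1 ho).neg_one_pow]
  · rw [cupVec_of_not_transversal (fun h => by simpa [mα, mβ] using t1.1 h),
      cupVec_of_not_transversal (fun h => by simpa [mα, mβ] using t2.1 h),
      cupVec_of_not_transversal (fun h => by simpa [mα, mβ] using t3.1 h)]
    simp

/-! ### Left endpoints and triangularity -/

/-- The left endpoints of the arcs. -/
def openers (D : TLDiagram n) : Finset ℕ := {x ∈ range (2 * n) | x ≤ D.arc x}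

theorem mem_openers (D : TLDiagram n) {x : ℕ} : x ∈ D.openers ↔ x < 2 * n ∧ x ≤ D.arc x := by
  simp [openers]

theorem openers_injective : Function.Injective (openers : TLDiagram n → Finset ℕ) := by
  intro D D' h
  have hop : ∀ x < 2 * n, x ≤ D.arc x ↔ x ≤ D'.arc x := fun x hx => by
    have := D.mem_openers (x := x)
    rw [h, mem_openers] at this
    tauto
  have key : ∀ d a, a < 2 * n → a < D.arc a → D.arc a - a = d → D'.arc a = D.arc a := by
    intro d
    induction d using Nat.strong_induction_on with
    | _ d ih =>
      -- Induction on the length of the arc: the arcs strictly below it agree by induction. Then the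
      -- second diagram can close `a` neither earlier nor later than the first.
      intro a ha hab hd
      have hb := D.arc_lt ha
      have hin : ∀ x, a < x → x < D.arc a → D'.arc x = D.arc x := by
        intro x hx1 hx2
        have hn := D.isCups.nest a x hx1 hx2
        rcases lt_or_gt_of_ne hn.2.2 with hlt | hlt
        · have := ih (D.arc (D.arc x) - D.arc x) (by rw [arc_arc]; omega) (D.arc x) (by omega)
            (by rwa [arc_arc]) rfl
          rw [arc_arc] at this
          exact (D'.arc_eq_comm.1 this).symm
        · exact ih (D.arc x - x) (by omega) x (by omega) hlt rfl
      have h1 : a < D'.arc a := lt_of_le_of_ne ((hop a ha).1 hab.le) (D'.arc_ne ha).symm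
      have h2 : D.arc a ≤ D'.arc a := by
        by_contra hc
        have h3 := hin _ h1 (by omega)
        rw [arc_arc] at h3
        have h4 := (D.isCups.nest a _ h1 (by omega)).1
        omega
      by_contra hne
      have h3 := D'.isCups.nest a (D.arc a) hab (by omega)
      have h4 : ¬ D.arc a ≤ D'.arc (D.arc a) := by
        rw [← hop _ hb, arc_arc]
        omega
      have h5 := hin _ h3.1 (by omega)
      rw [arc_arc] at h5
      have h6 := D.isCups.nest a _ h3.1 (by omega)
      omega
  apply arc_injective
  funext x
  by_cases hx : x < 2 * n
  · rcases lt_or_gt_of_ne (D.arc_ne hx) with hlt | hlt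
    · have := key _ (D.arc x) (D.arc_lt hx) (by rwa [arc_arc]) rfl
      rw [arc_arc] at this
      exact D'.arc_eq_comm.1 this
    · exact (key _ x hx hlt rfl).symm
  · rw [D.arc_of_le (not_lt.1 hx), D'.arc_of_le (not_lt.1 hx)]

theorem transversal_openers (D : TLDiagram n) : IsTransversal (2 * n) D.arc D.openers :=
  D.isCups.isTransversal_openers

theorem openers_subset (D : TLDiagram n) : D.openers ⊆ range (2 * n) := filter_subset _ _

/-- The openers have the least sum among the transversals. -/
theorem eq_openers_of_sum_le (D : TLDiagram n) {S : Finset ℕ}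
    (hS : IsTransversal (2 * n) D.arc S) (hsub : S ⊆ range (2 * n))
    (hle : ∑ x ∈ S, x ≤ ∑ x ∈ D.openers, x) : S = D.openers := by
  rw [transversal_iff] at hS
  have hlt : ∀ x ∈ S, x < 2 * n := fun x hx => mem_range.1 (hsub hx)
  -- Sliding every chosen endpoint to the left end of its arc is a bijection onto the openers and
  -- never increases a point.
  have hmaps : ∀ x ∈ S, min x (D.arc x) ∈ D.openers := by
    intro x hx
    rw [mem_openers]
    rcases le_total x (D.arc x) with h | h
    · rw [min_eq_left h]
      exact ⟨hlt x hx, h⟩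
    · rw [min_eq_right h, arc_arc]
      exact ⟨D.arc_lt (hlt x hx), h⟩
  have hinj : Set.InjOn (fun x => min x (D.arc x)) S := by
    intro x hx y hy e
    have h1 := hS x (hlt x hx)
    have hne : D.arc x ≠ y := fun h => h1.1 (h ▸ hy) hx
    have hne' : x ≠ D.arc y := fun h => hne (D.arc_eq_comm.2 h)
    have hinj := fun h => D.arc_inj (x := x) (y := y) h
    dsimp only at e
    rcases le_total x (D.arc x) with h | h <;> rcases le_total y (D.arc y) with h' | h' <;>
      simp only [min_eq_left h, min_eq_right h, min_eq_left h', min_eq_right h'] at e <;> tauto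
  have hsurj : ∀ y ∈ D.openers, ∃ x ∈ S, min x (D.arc x) = y := by
    intro y hy
    rw [mem_openers] at hy
    by_cases h : y ∈ S
    · exact ⟨y, h, min_eq_left hy.2⟩
    · exact ⟨D.arc y, (hS y hy.1).2 h, by rw [arc_arc, min_eq_right hy.2]⟩
  have hsum : ∑ x ∈ S, min x (D.arc x) = ∑ x ∈ D.openers, x :=
    sum_nbij (fun x => min x (D.arc x)) hmaps hinj (fun y hy => hsurj y hy) (fun _ _ => rfl)
  have heq : ∀ x ∈ S, min x (D.arc x) = x := by
    refine (sum_eq_sum_iff_of_le fun x _ => min_le_left _ _).1 (le_antisymm ?_ (hsum ▸ hle))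
    exact sum_le_sum fun x _ => min_le_left _ _
  refine Subset.antisymm (fun x hx => heq x hx ▸ hmaps x hx) fun y hy => ?_
  obtain ⟨x, hx, rfl⟩ := hsurj y hy
  rwa [heq x hx]

end TLDiagram

namespace TL

open Finset TLDiagram

variable {K : Type*} [Field K] {n : ℕ}

/-! ### The linear map attached to the vectors of diagrams -/

variable (K n) in
/-- The linear map that sends a diagram to its vector. -/
noncomputable def cupMap : TL K n →ₗ[K] (Finset ℕ → K) :=
  Finsupp.linearCombination K fun D : TLDiagram n => cupVec K (2 * n) D.arc

theorem cupMap_single (D : TLDiagram n) (c : K) (S : Finset ℕ) :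
    cupMap K n (Finsupp.single D c) S = c * cupVec K (2 * n) D.arc S := by
  simp [cupMap]

theorem cupMap_apply (X : TL K n) (S : Finset ℕ) :
    cupMap K n X S = ∑ D ∈ X.support, X D * cupVec K (2 * n) D.arc S := by
  simp [cupMap, Finsupp.linearCombination_apply, Finsupp.sum]

/-- Among the diagrams of the support take one with least sum of left endpoints. At its set of
openers no other diagram of the support contributes. -/
theorem eq_zero_of_cupMap {X : TL K n}
    (h : ∀ S ⊆ range (2 * n), #S = n → cupMap K n X S = 0) : X = 0 := by
  by_contra hX
  obtain ⟨D, hD, hmin⟩ := exists_min_image X.support (fun D => ∑ x ∈ D.openers, x)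
    (Finsupp.support_nonempty_iff.2 hX)
  have h1 := h D.openers D.openers_subset D.card_openers
  rw [cupMap_apply, sum_eq_single_of_mem D hD] at h1
  · exact mul_ne_zero (Finsupp.mem_support_iff.1 hD) (cupVec_ne_zero D.transversal_openers) h1
  · intro D' hD' hne
    rw [cupVec_of_not_transversal, mul_zero]
    exact fun ht => hne (openers_injective
      (D'.eq_openers_of_sum_le ht D.openers_subset (hmin D' hD')).symm)

theorem cupMap_mem_cupSpan (X : TL K n) : cupMap K n X ∈ cupSpan K (2 * n) n := by
  rw [cupMap, Finsupp.linearCombination_apply]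
  exact Submodule.sum_mem _ fun D _ =>
    Submodule.smul_mem _ _ (Submodule.subset_span ⟨_, D.isCups, rfl⟩)

theorem exists_cupMap_eq {u : Finset ℕ → K} (hu : u ∈ cupSpan K (2 * n) n) :
    ∃ X, cupMap K n X = u := by
  have : cupSpan K (2 * n) n ≤ LinearMap.range (cupMap K n) := by
    rw [cupSpan, Submodule.span_le]
    rintro _ ⟨π, h, rfl⟩
    obtain ⟨D, rfl⟩ := exists_arc_eq h
    refine ⟨Finsupp.single D 1, ?_⟩
    ext S
    rw [cupMap_single, one_mul]
  exact this hu

/-! ### Capping two neighbouring points -/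

/-- Capping off the points `a` and `a + 1` and creating a new arc between them. -/
noncomputable def capped (a : ℕ) (ha : a + 1 < 2 * n) : TL K n →ₗ[K] TL K n :=
  Finsupp.linearCombination K fun D : TLDiagram n =>
    if D.arc a = a + 1 then 0 else Finsupp.single (D.surg a ha) 1

theorem capped_single {a : ℕ} (ha : a + 1 < 2 * n) (D : TLDiagram n) (c : K) :
    capped a ha (Finsupp.single D c) =
      c • if D.arc a = a + 1 then 0 else Finsupp.single (D.surg a ha) 1 := by
  simp [capped]

theorem arc_surg_self (D : TLDiagram n) {a : ℕ} (ha : a + 1 < 2 * n) :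
    (D.surg a ha).arc a = a + 1 := by
  rw [arc_surg _ _ (by omega), surgArc, if_pos rfl]

theorem cupMap_sub_cupMap (X : TL K n) {a : ℕ} (ha : a + 1 < 2 * n) {S : Finset ℕ}
    (haS : a ∈ S) (haS' : a + 1 ∉ S) (hS : S ⊆ range (2 * n)) :
    cupMap K n X S - cupMap K n X (insert (a + 1) (S.erase a)) =
      (-1) ^ a * cupMap K n (capped a ha X) S := by
  induction X using Finsupp.induction_linear with
  | zero => simp
  | add X Y hX hY =>
    simp only [map_add, Pi.add_apply]
    linear_combination hX + hY
  | single D c =>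
    rw [cupMap_single, cupMap_single, ← mul_sub, D.cupVec_sub_cupVec ha haS haS' hS, capped_single]
    split_ifs
    · simp
    · rw [map_smul, Pi.smul_apply, cupMap_single, smul_eq_mul]
      ring

/-- The second cap closes a loop, which has the value `0`. -/
theorem capped_capped (X : TL K n) {a : ℕ} (ha : a + 1 < 2 * n) :
    capped a ha (capped a ha X) = 0 := by
  induction X using Finsupp.induction_linear with
  | zero => simp
  | add X Y hX hY => rw [map_add, map_add, hX, hY, add_zero]
  | single D c =>
    rw [capped_single]
    split_ifs
    · simp
    · rw [map_smul, capped_single, if_pos (arc_surg_self D ha)]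
      simp

theorem cupMap_capped_eq_zero (X : TL K n) {a : ℕ} (ha : a + 1 < 2 * n) {S : Finset ℕ}
    (h : a ∈ S ↔ a + 1 ∈ S) : cupMap K n (capped a ha X) S = 0 := by
  induction X using Finsupp.induction_linear with
  | zero => simp
  | add X Y hX hY => rw [map_add, map_add, Pi.add_apply, hX, hY, add_zero]
  | single D c =>
    rw [capped_single]
    split_ifs
    · simp
    · rw [map_smul, Pi.smul_apply, cupMap_single, cupVec_of_not_transversal]
      · simp
      · intro ht
        have := (D.surg a ha).transversal_iff.1 ht a (by omega)
        rw [arc_surg_self] at this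
        tauto

/-- By injectivity it suffices to look at vectors. The hypothesis handles sets containing `a` only;
`capped_capped` makes the vector of the capped element symmetric in `a` and `a + 1`, which handles
sets containing `a + 1` only. -/
theorem capped_eq_zero_of_cupMap {X : TL K n} {a : ℕ} (ha : a + 1 < 2 * n)
    (h : ∀ S ⊆ range (2 * n), #S = n → a ∈ S → a + 1 ∉ S →
      cupMap K n X S = cupMap K n X (insert (a + 1) (S.erase a))) : capped a ha X = 0 := by
  have key : ∀ S ⊆ range (2 * n), #S = n → a ∈ S → a + 1 ∉ S →
      cupMap K n (capped a ha X) S = 0 := by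
    intro S hS hc h1 h2
    have := cupMap_sub_cupMap X ha h1 h2 hS
    rw [h S hS hc h1 h2, sub_self] at this
    simpa using this.symm
  refine eq_zero_of_cupMap fun S hS hc => ?_
  by_cases h1 : a ∈ S <;> by_cases h2 : a + 1 ∈ S
  · exact cupMap_capped_eq_zero X ha (by tauto)
  · exact key S hS hc h1 h2
  · have hne : a ≠ a + 1 := by omega
    have hsub : insert a (S.erase (a + 1)) ⊆ range (2 * n) :=
      insert_subset (mem_range.2 (by omega)) ((erase_subset _ _).trans hS)
    have hcard : #(insert a (S.erase (a + 1))) = n := by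
      rw [card_insert_of_notMem (by simp [h1]), card_erase_add_one h2, hc]
    have hmem : a + 1 ∉ insert a (S.erase (a + 1)) := by simp
    have h3 := cupMap_sub_cupMap (capped a ha X) ha (mem_insert_self a (S.erase (a + 1))) hmem hsub
    rw [capped_capped, key _ hsub hcard (mem_insert_self _ _) hmem, erase_insert (by simp [h1]),
      insert_erase h2] at h3
    simpa using h3
  · exact cupMap_capped_eq_zero X ha (by tauto)

/-! ### Functions invariant under moving a point to a neighbouring position -/

theorem eq_Ico_of_downward {S : Finset ℕ} {s : ℕ} (h : ∀ a, s ≤ a → a + 1 ∈ S → a ∈ S)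
    (hs : ∀ x ∈ S, s ≤ x) : S = Ico s (s + #S) := by
  refine eq_of_subset_of_card_le (fun x hx => ?_) (by simp)
  have hd : ∀ k ≤ x, s ≤ x - k → x - k ∈ S := by
    intro k
    induction k with
    | zero => intro _ _; exact hx
    | succ k ih =>
      intro h1 h2
      exact h _ h2 (by have := ih (by omega) (by omega); rwa [show x - (k + 1) + 1 = x - k by omega])
  have hsub : Ico s (x + 1) ⊆ S := by
    intro y hy
    rw [mem_Ico] at hy
    have := hd (x - y) (by omega) (by omega)
    rwa [show x - (x - y) = y by omega] at this
  have := card_le_card hsub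
  rw [Nat.card_Ico] at this
  have := hs x hx
  rw [mem_Ico]
  omega

/-- Points at positions above `s` are pushed down one step at a time. Each step lowers the sum of
the set, so the process ends with all points `≥ s` packed against `s`. -/
theorem exists_downward {R : Type*} (g : Finset ℕ → R) (s N : ℕ)
    (h : ∀ a, s ≤ a → a + 1 < N → ∀ S ⊆ range N, #S = n → a ∈ S → a + 1 ∉ S →
      g S = g (insert (a + 1) (S.erase a))) (k : ℕ) :
    ∀ S ⊆ range N, #S = n → ∑ x ∈ S, x = k → ∃ S' ⊆ range N, #S' = n ∧
      (∀ x < s, x ∈ S' ↔ x ∈ S) ∧ (∀ a, s ≤ a → a + 1 ∈ S' → a ∈ S') ∧ g S = g S' := by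
  induction k using Nat.strong_induction_on with
  | _ k ih =>
    intro S hS hc hk
    by_cases hdown : ∀ a, s ≤ a → a + 1 ∈ S → a ∈ S
    · exact ⟨S, hS, hc, fun _ _ => Iff.rfl, hdown, rfl⟩
    push Not at hdown
    obtain ⟨a, hsa, h2, h1⟩ := hdown
    have haN := mem_range.1 (hS h2)
    have hsub : insert a (S.erase (a + 1)) ⊆ range N :=
      insert_subset (mem_range.2 (by omega)) ((erase_subset _ _).trans hS)
    have hcard : #(insert a (S.erase (a + 1))) = n := by
      rw [card_insert_of_notMem (by simp [h1]), card_erase_add_one h2, hc]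
    have hmem : a + 1 ∉ insert a (S.erase (a + 1)) := by simp
    have h3 := h a hsa haN _ hsub hcard (mem_insert_self _ _) hmem
    rw [erase_insert (by simp [h1]), insert_erase h2] at h3
    have hsum : ∑ x ∈ insert a (S.erase (a + 1)), x < k := by
      rw [sum_insert (by simp [h1]), ← hk, ← add_sum_erase S (fun x => x) h2]
      omega
    obtain ⟨S', e1, e2, e3, e4, e5⟩ := ih _ hsum _ hsub hcard rfl
    refine ⟨S', e1, e2, fun x hx => ?_, e4, h3.symm.trans e5⟩
    rw [e3 x hx, mem_insert, mem_erase]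
    constructor
    · rintro (h | h)
      · omega
      · exact h.2
    · exact fun h => .inr ⟨by omega, h⟩

theorem cupMap_swap {X : TL K n} {a : ℕ} (ha : a + 1 < 2 * n) (hX : capped a ha X = 0)
    (S : Finset ℕ) (hS : S ⊆ range (2 * n)) (h1 : a ∈ S) (h2 : a + 1 ∉ S) :
    cupMap K n X S = cupMap K n X (insert (a + 1) (S.erase a)) := by
  have := cupMap_sub_cupMap X ha h1 h2 hS
  rw [hX] at this
  simpa [sub_eq_zero] using this

/-- An element annihilated by all caps has a constant vector. -/
theorem cupMap_eq_of_capped {X : TL K n} (h : ∀ a (ha : a + 1 < 2 * n), capped a ha X = 0)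
    {S : Finset ℕ} (hS : S ⊆ range (2 * n)) (hc : #S = n) :
    cupMap K n X S = cupMap K n X (range n) := by
  obtain ⟨S', -, e2, -, e4, e5⟩ := exists_downward (cupMap K n X) 0 (2 * n)
    (fun a _ ha S hS _ h1 h2 => cupMap_swap ha (h a ha) S hS h1 h2) _ S hS hc rfl
  have := eq_Ico_of_downward e4 fun _ _ => Nat.zero_le _
  rw [e2, zero_add, ← range_eq_Ico] at this
  rw [e5, this]

/-- For odd `n` the first cap may be omitted. -/
theorem cupMap_eq_of_capped_pos (hn : Odd n) {X : TL K n}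
    (h : ∀ a (ha : a + 1 < 2 * n), 1 ≤ a → capped a ha X = 0)
    {S : Finset ℕ} (hS : S ⊆ range (2 * n)) (hc : #S = n) :
    cupMap K n X S = cupMap K n X (range n) := by
  have hpos := hn.pos
  -- Without the cap at `0` the value can still depend on whether `0 ∈ S`, and on nothing else.
  have key : ∀ S ⊆ range (2 * n), #S = n → (0 ∈ S → cupMap K n X S = cupMap K n X (range n)) ∧
      (0 ∉ S → cupMap K n X S = cupMap K n X (Ico 1 (1 + n))) := by
    intro S hS hc
    obtain ⟨S', -, e2, e3, e4, e5⟩ := exists_downward (cupMap K n X) 1 (2 * n)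
      (fun a h0 ha S hS _ h1 h2 => cupMap_swap ha (h a ha h0) S hS h1 h2) _ S hS hc rfl
    have h0 := e3 0 one_pos
    refine ⟨fun h1 => ?_, fun h1 => ?_⟩
    · have := eq_Ico_of_downward (S := S') (s := 0) (fun a _ ha => by
        by_cases c : a = 0
        · rw [c]; exact h0.2 h1
        · exact e4 a (by omega) ha) fun _ _ => Nat.zero_le _
      rw [e2, zero_add, ← range_eq_Ico] at this
      rw [e5, this]
    · have := eq_Ico_of_downward e4 fun x hx => by
        by_contra hc
        obtain rfl : x = 0 := by omega
        exact h1 (h0.1 hx)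
      rw [e2] at this
      rw [e5, this]
  have hT : range (n + 1) ⊆ range (2 * n) := range_mono (by omega)
  -- For odd `n` the constants pass the test on `n + 1` points as well. Only one `n`-subset of
  -- `range (n + 1)` omits `0`, so this test compares the two remaining values.
  have h1 : altSum K n (range (n + 1)) (cupMap K n X - cupMap K n X (range n) • fun _ => 1) = 0 := by
    rw [map_sub, map_smul, altSum_cupSpan (cupMap_mem_cupSpan X) hT (by simp), altSum_one]
    obtain ⟨j, rfl⟩ := hn
    rw [card_range, show 2 * j + 1 + 1 = 2 * (j + 1) by ring, (altChoose_even (j + 1)).2]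
    simp
  have hI : Ico 1 (1 + n) ∈ (range (n + 1)).powersetCard n := by
    rw [mem_powersetCard]
    refine ⟨fun x hx => ?_, by simp⟩
    rw [mem_Ico] at hx
    rw [mem_range]
    omega
  rw [altSum_apply, sum_eq_single_of_mem _ hI] at h1
  · have h2 : cupMap K n X (Ico 1 (1 + n)) = cupMap K n X (range n) := by
      simpa [sub_eq_zero] using h1
    by_cases h0 : 0 ∈ S
    · exact (key S hS hc).1 h0
    · rw [(key S hS hc).2 h0, h2]
  · intro S hS hne
    rw [mem_powersetCard] at hS
    have h0 : 0 ∈ S := by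
      by_contra h0
      refine hne (eq_of_subset_of_card_le (fun x hx => ?_) (by simp [hS.2]))
      have := mem_range.1 (hS.1 hx)
      have : x ≠ 0 := fun h => h0 (h ▸ hx)
      rw [mem_Ico]
      omega
    rw [Pi.sub_apply, (key S (hS.1.trans hT) hS.2).1 h0]
    simp

/-! ### Rotation -/

theorem finRotate_mk {N x : ℕ} (h : x + 1 < N) :
    finRotate N ⟨x, by omega⟩ = ⟨x + 1, h⟩ := by
  apply Fin.ext
  rw [finRotate_val, if_neg (by simp; omega)]

theorem partner_rotateCCW (D : TLDiagram n) (x : Fin (2 * n)) :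
    D.rotateCCW.partner (finRotate _ x) = finRotate _ (D.partner x) := by
  rw [rotateCCW]
  dsimp only
  rw [Equiv.symm_apply_apply]

theorem arc_eq_iff (D : TLDiagram n) (x y : Fin (2 * n)) : D.arc x = y ↔ D.partner x = y := by
  rw [arc_val, Fin.ext_iff]

theorem partner_surg (D : TLDiagram n) {a : ℕ} (ha : a + 1 < 2 * n) (x : Fin (2 * n)) :
    (D.surg a ha).partner x =
      if x = ⟨a, by omega⟩ then ⟨a + 1, ha⟩ else if x = ⟨a + 1, ha⟩ then ⟨a, by omega⟩ else
      if x = D.partner ⟨a, by omega⟩ then D.partner ⟨a + 1, ha⟩ else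
      if x = D.partner ⟨a + 1, ha⟩ then D.partner ⟨a, by omega⟩ else D.partner x := by
  apply Fin.ext
  have h := D.arc_surg ha x.isLt
  rw [arc_val, surgArc, arc_of_lt D ha, arc_of_lt D (by omega : a < 2 * n), arc_val] at h
  rw [h]
  simp only [Fin.ext_iff]
  split_ifs <;> rfl

theorem surg_rotateCCW (D : TLDiagram n) {a : ℕ} (ha : a + 1 + 1 < 2 * n) :
    D.rotateCCW.surg (a + 1) ha = (D.surg a (by omega)).rotateCCW := by
  refine TLDiagram.ext (funext fun x => ?_)
  obtain ⟨x, rfl⟩ := (finRotate (2 * n)).surjective x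
  rw [partner_rotateCCW, partner_surg, partner_surg, partner_rotateCCW, ← finRotate_mk ha,
    ← finRotate_mk (by omega : a + 1 < 2 * n), partner_rotateCCW, partner_rotateCCW]
  simp only [EmbeddingLike.apply_eq_iff_eq]
  split_ifs <;> rfl

theorem arc_rotateCCW_iff (D : TLDiagram n) {a : ℕ} (ha : a + 1 + 1 < 2 * n) :
    D.rotateCCW.arc (a + 1) = a + 1 + 1 ↔ D.arc a = a + 1 := by
  have h1 := arc_eq_iff D ⟨a, by omega⟩ ⟨a + 1, by omega⟩
  have h2 := arc_eq_iff D.rotateCCW ⟨a + 1, by omega⟩ ⟨a + 1 + 1, ha⟩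
  rw [← finRotate_mk ha, ← finRotate_mk (by omega : a + 1 < 2 * n), partner_rotateCCW,
    EmbeddingLike.apply_eq_iff_eq] at h2
  rw [finRotate_mk (by omega : a + 1 < 2 * n), finRotate_mk ha] at h2
  exact h2.trans h1.symm

/-- Rotation shifts caps by one position. The bound excludes the cap that would wrap around to
position `0`. -/
theorem capped_rotateCCW (X : TL K n) {a : ℕ} (ha : a + 1 + 1 < 2 * n) :
    capped (a + 1) ha (Finsupp.mapDomain rotateCCW X) =
      Finsupp.mapDomain rotateCCW (capped a (by omega) X) := by
  induction X using Finsupp.induction_linear with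
  | zero => simp
  | add X Y hX hY => simp only [Finsupp.mapDomain_add, map_add, hX, hY]
  | single D c =>
    rw [Finsupp.mapDomain_single, capped_single, capped_single, Finsupp.mapDomain_smul]
    by_cases hc : D.arc a = a + 1
    · rw [if_pos hc, if_pos ((arc_rotateCCW_iff D ha).2 hc), Finsupp.mapDomain_zero]
    · rw [if_neg hc, if_neg (fun h => hc ((arc_rotateCCW_iff D ha).1 h)), surg_rotateCCW,
        Finsupp.mapDomain_single]

theorem rotateCW_rotateCCW (D : TLDiagram n) : D.rotateCCW.rotateCW = D := by
  refine TLDiagram.ext (funext fun x => ?_)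
  rw [rotateCW, rotateCCW]
  dsimp only
  rw [Equiv.symm_apply_apply, Equiv.symm_apply_apply]

theorem mapDomain_rotateCW_rotateCCW (X : TL K n) :
    Finsupp.mapDomain rotateCW (Finsupp.mapDomain rotateCCW X) = X := by
  rw [← Finsupp.mapDomain_comp, show (rotateCW ∘ rotateCCW : TLDiagram n → _) = id from
    funext rotateCW_rotateCCW, Finsupp.mapDomain_id]

theorem mapDomain_rotateCCW_ne_zero {X : TL K n} (hX : X ≠ 0) :
    Finsupp.mapDomain rotateCCW X ≠ 0 := fun h => hX (by
  rw [← mapDomain_rotateCW_rotateCCW X, h, Finsupp.mapDomain_zero])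

end TL

/-! ### Products with the generators -/

namespace TLDiagram

variable {n : ℕ}

theorem stack_adj_inl (A B : TLDiagram n) (x : Fin (2 * n)) :
    (stack A B).Adj (Sum.inl x) (Sum.inl (A.partner x)) := by
  simp [stack, (A.partner_ne x).symm]

theorem stack_adj_inr (A B : TLDiagram n) (x : Fin (2 * n)) :
    (stack A B).Adj (Sum.inr x) (Sum.inr (B.partner x)) := by
  simp [stack, (B.partner_ne x).symm]

theorem stack_adj_glue (A B : TLDiagram n) {x : Fin (2 * n)} (hx : x.val < n) :
    (stack A B).Adj (Sum.inl x) (Sum.inr x.rev) := by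
  simp [stack, hx]

/-- A labelling of the boundary points of a stacked picture which is constant on arcs and glued
points is constant on connected components. -/
theorem stack_label {A B : TLDiagram n} {T : Type*} {f : Fin (2 * n) ⊕ Fin (2 * n) → T}
    (h1 : ∀ x, f (Sum.inl (A.partner x)) = f (Sum.inl x))
    (h2 : ∀ x, f (Sum.inr (B.partner x)) = f (Sum.inr x))
    (h3 : ∀ x : Fin (2 * n), x.val < n → f (Sum.inl x) = f (Sum.inr x.rev))
    {u v : Fin (2 * n) ⊕ Fin (2 * n)} (h : (stack A B).Reachable u v) : f u = f v := by
  have hadj : ∀ u v, (stack A B).Adj u v → f u = f v := by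
    intro u v huv
    rw [stack, SimpleGraph.fromRel_adj] at huv
    obtain ⟨-, huv⟩ := huv
    rcases u with x | x <;> rcases v with y | y
    · rcases huv with rfl | rfl
      · exact (h1 _).symm
      · exact h1 _
    · obtain ⟨hx, rfl⟩ : x.val < n ∧ y = x.rev := by simpa using huv
      exact h3 x hx
    · obtain ⟨hx, rfl⟩ : y.val < n ∧ x = y.rev := by simpa using huv
      exact (h3 y hx).symm
    · rcases huv with rfl | rfl
      · exact (h2 _).symm
      · exact h2 _
  obtain ⟨p⟩ := h
  induction p with
  | nil => rfl
  | cons h _ ih => exact (hadj _ _ h).trans ih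

/-- The stacked picture of `A` and `B` is obtained from the diagram `D` by capping off the
neighbouring points `a` and `b`. Here `inn` gives the boundary points of the copy of `D`. -/
structure IsCapping (A B D : TLDiagram n) (a b : Fin (2 * n))
    (inn : Fin (2 * n) → Fin (2 * n) ⊕ Fin (2 * n)) : Prop where
  succ : a.val + 1 = b.val
  reach_strand : ∀ y, y ≠ a → y ≠ b → (stack A B).Reachable (outer y) (inn y)
  reach_outer : (stack A B).Reachable (outer a) (outer b)
  reach_inner : (stack A B).Reachable (inn a) (inn b)
  reach_arc : ∀ y, (stack A B).Reachable (inn y) (inn (D.partner y))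
  cover : ∀ v, (∃ y, v = outer y) ∨ ∃ y, (stack A B).Reachable v (inn y)
  label : ∀ F L : Fin (2 * n) → Sym2 ℕ, F a = F b → L a = L b →
    (∀ y, y ≠ a → y ≠ b → L y = F y) → (∀ y, L (D.partner y) = L y) →
    ∃ f : Fin (2 * n) ⊕ Fin (2 * n) → Sym2 ℕ,
      (∀ u v, (stack A B).Reachable u v → f u = f v) ∧ (∀ y, f (outer y) = F y) ∧
        ∀ y, f (inn y) = L y

namespace IsCapping

variable {A B D : TLDiagram n} {a b : Fin (2 * n)} {inn : Fin (2 * n) → Fin (2 * n) ⊕ Fin (2 * n)}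

theorem ne (h : IsCapping A B D a b inn) : a ≠ b := fun hab => by
  have := h.succ
  rw [hab] at this
  omega

theorem lt (h : IsCapping A B D a b inn) : a.val + 1 < 2 * n := by
  rw [h.succ]
  exact b.isLt

theorem arc_eq_iff (h : IsCapping A B D a b inn) : D.arc a = a + 1 ↔ D.partner a = b := by
  rw [arc_val, h.succ, Fin.ext_iff]

theorem partner_surg (h : IsCapping A B D a b inn) (x : Fin (2 * n)) :
    (D.surg a h.lt).partner x = if x = a then b else if x = b then a else
      if x = D.partner a then D.partner b else if x = D.partner b then D.partner a
      else D.partner x := by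
  have hb : (⟨a.val + 1, h.lt⟩ : Fin (2 * n)) = b := Fin.ext h.succ
  rw [TL.partner_surg, hb]

/-- The field `label` yields invariants of components. Here one label marks the inner points `a` and
`b` and separates their component from the outer boundary. -/
theorem loops_ne_zero (h : IsCapping A B D a b inn) (hc : D.partner a = b) : loops A B ≠ 0 := by
  classical
  have hc' : D.partner b = a := by rw [← hc, D.partner_partner]
  obtain ⟨f, hf, hF, hL⟩ := h.label (fun _ => s(0, 0))
    (fun y => if y = a ∨ y = b then s(0, 1) else s(0, 0)) rfl (by simp)
    (fun y h1 h2 => by simp [h1, h2]) (fun y => by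
      by_cases h1 : y = a
      · simp [h1, hc]
      by_cases h2 : y = b
      · simp [h2, hc']
      have h3 : D.partner y ≠ a := fun e => h2 (by rw [← hc, ← e, D.partner_partner])
      have h4 : D.partner y ≠ b := fun e => h1 (by rw [← hc', ← e, D.partner_partner])
      simp [h1, h2, h3, h4])
  have hne : Nonempty {c : (stack A B).ConnectedComponent //
      ∀ x, c ≠ (stack A B).connectedComponentMk (outer x)} := by
    refine ⟨(stack A B).connectedComponentMk (inn a), fun x hx => ?_⟩
    have := hf _ _ (SimpleGraph.ConnectedComponent.exact hx)
    rw [hL, hF] at this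
    simp at this
  exact Nat.card_pos.ne'

theorem isComposite (h : IsCapping A B D a b inn) (hc : D.partner a ≠ b) :
    IsComposite A B (D.surg a h.lt) := by
  classical
  have hpa := D.partner_ne a
  have hpb := D.partner_ne b
  have hc' : D.partner b ≠ a := fun e => hc (by rw [← e, D.partner_partner])
  have hab : D.partner a ≠ D.partner b := fun e => h.ne (by
    rw [← D.partner_partner a, e, D.partner_partner])
  have hsurg := h.partner_surg
  have sa : (D.surg a h.lt).partner a = b := by rw [hsurg, if_pos rfl]
  have sb : (D.surg a h.lt).partner b = a := by rw [hsurg, if_neg h.ne.symm, if_pos rfl]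
  have sα : (D.surg a h.lt).partner (D.partner a) = D.partner b := by
    rw [hsurg, if_neg hpa, if_neg hc, if_pos rfl]
  have sβ : (D.surg a h.lt).partner (D.partner b) = D.partner a := by
    rw [hsurg, if_neg hc', if_neg hpb, if_neg hab.symm, if_pos rfl]
  have so : ∀ y, y ≠ a → y ≠ b → y ≠ D.partner a → y ≠ D.partner b →
      (D.surg a h.lt).partner y = D.partner y := fun y h1 h2 h3 h4 => by
    rw [hsurg, if_neg h1, if_neg h2, if_neg h3, if_neg h4]
  have hreach : ∀ x, (stack A B).Reachable (outer x) (outer ((D.surg a h.lt).partner x)) := by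
    have hαβ : (stack A B).Reachable (outer (D.partner a)) (outer (D.partner b)) :=
      (h.reach_strand _ hpa hc).trans <| (h.reach_arc a).symm.trans <| h.reach_inner.trans <|
        (h.reach_arc b).trans (h.reach_strand _ hc' hpb).symm
    intro x
    by_cases h1 : x = a
    · rw [h1, sa]; exact h.reach_outer
    by_cases h2 : x = b
    · rw [h2, sb]; exact h.reach_outer.symm
    by_cases h3 : x = D.partner a
    · rw [h3, sα]; exact hαβ
    by_cases h4 : x = D.partner b
    · rw [h4, sβ]; exact hαβ.symm
    rw [so x h1 h2 h3 h4]
    refine (h.reach_strand x h1 h2).trans ((h.reach_arc x).trans (h.reach_strand _ ?_ ?_).symm)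
    · exact fun e => h3 (by rw [← e, D.partner_partner])
    · exact fun e => h4 (by rw [← e, D.partner_partner])
  -- Every component is labelled by the unordered pair of its expected outer endpoints, so connected
  -- outer points are equal or partners. The inner points `a` and `b` lie on the strand between
  -- their former partners.
  obtain ⟨f, hf, hF, -⟩ := h.label
    (fun y => s(y.val, ((D.surg a h.lt).partner y).val))
    (fun y => if y = a ∨ y = b then s((D.partner a).val, (D.partner b).val) else
      s(y.val, ((D.surg a h.lt).partner y).val))
    (by rw [sa, sb, Sym2.eq_swap]) (by simp) (fun y h1 h2 => by simp [h1, h2]) (fun y => by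
      by_cases h1 : y = a
      · simp [h1, hpa, hc, sα]
      by_cases h2 : y = b
      · simp [h2, hpb, hc', sβ]
      by_cases h3 : y = D.partner a
      · simp [h3, D.partner_partner, hpa, hc, sα]
      by_cases h4 : y = D.partner b
      · simp [h4, D.partner_partner, hpb, hc', sβ]
      have h5 : D.partner y ≠ a := fun e => h3 (by rw [← e, D.partner_partner])
      have h6 : D.partner y ≠ b := fun e => h4 (by rw [← e, D.partner_partner])
      have h7 := so y h1 h2 h3 h4
      have h8 : (D.surg a h.lt).partner (D.partner y) = y := by
        rw [← h7, TLDiagram.partner_partner]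
      simp only [h1, h2, h5, h6, or_self, if_false]
      rw [h7, h8, Sym2.eq_swap])
  intro x y
  constructor
  · rintro rfl
    exact ⟨(TLDiagram.partner_ne _ x).symm, hreach x⟩
  · rintro ⟨hne, hr⟩
    have := hf _ _ hr
    rw [hF, hF, Sym2.eq_iff] at this
    rcases this with h1 | h1
    · exact absurd (Fin.ext h1.1) hne
    · exact Fin.ext h1.2

theorem loops_eq_zero (h : IsCapping A B D a b inn) (hc : D.partner a ≠ b) : loops A B = 0 := by
  have hpa := D.partner_ne a
  have hpb := D.partner_ne b
  have hc' : D.partner b ≠ a := fun e => hc (by rw [← e, D.partner_partner])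
  have hinn : ∀ y, ∃ x, (stack A B).Reachable (inn y) (outer x) := by
    intro y
    by_cases h1 : y = a
    · exact ⟨_, h1 ▸ (h.reach_arc a).trans (h.reach_strand _ hpa hc).symm⟩
    by_cases h2 : y = b
    · exact ⟨_, h2 ▸ (h.reach_arc b).trans (h.reach_strand _ hc' hpb).symm⟩
    exact ⟨y, (h.reach_strand y h1 h2).symm⟩
  have : IsEmpty {c : (stack A B).ConnectedComponent //
      ∀ x, c ≠ (stack A B).connectedComponentMk (outer x)} := by
    refine ⟨fun ⟨c, hcomp⟩ => ?_⟩
    induction c using SimpleGraph.ConnectedComponent.ind with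
    | _ v =>
      rcases h.cover v with ⟨y, rfl⟩ | ⟨y, hy⟩
      · exact hcomp y rfl
      · obtain ⟨x, hx⟩ := hinn y
        exact hcomp x (SimpleGraph.ConnectedComponent.sound (hy.trans hx))
  exact Nat.card_eq_zero.2 (.inl this)

theorem diagramMul_eq (h : IsCapping A B D a b inn) (K : Type*) [Field K] :
    TL.diagramMul (0 : K) A B =
      if D.arc a = a + 1 then 0 else Finsupp.single (D.surg a h.lt) 1 := by
  rw [TL.diagramMul]
  by_cases hc : D.partner a = b
  · rw [if_pos (h.arc_eq_iff.2 hc), zero_pow (h.loops_ne_zero hc)]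
    split_ifs <;> simp
  · have hex : ∃ D, IsComposite A B D := ⟨_, h.isComposite hc⟩
    rw [if_neg (fun e => hc (h.arc_eq_iff.1 e)), dif_pos hex, h.loops_eq_zero hc, pow_zero,
      hex.choose_spec.unique (h.isComposite hc)]

end IsCapping

/-! ### Stacking with a generator as a capping -/

theorem outer_of_lt {x : Fin (2 * n)} (hx : x.val < n) : outer x = Sum.inr x := if_pos hx

theorem outer_of_le {x : Fin (2 * n)} (hx : n ≤ x.val) : outer x = Sum.inl x :=
  if_neg (not_lt.2 hx)

theorem cupCap_partner (i : ℕ) (hi : i + 1 < n) (x : Fin (2 * n)) :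
    (cupCap n i hi).partner x = cupCapPartner n i hi x := rfl

theorem cupCap_partner_of_ne (i : ℕ) (hi : i + 1 < n) {x : Fin (2 * n)} (h1 : x.val ≠ i)
    (h2 : x.val ≠ i + 1) (h3 : x.val ≠ 2 * n - 1 - i) (h4 : x.val ≠ 2 * n - 2 - i) :
    (cupCap n i hi).partner x = x.rev := by
  rw [cupCap_partner, cupCapPartner, if_neg h1, if_neg h2, if_neg h3, if_neg h4]

theorem cupCap_partner_bot (i : ℕ) (hi : i + 1 < n) :
    (cupCap n i hi).partner ⟨i, by omega⟩ = ⟨i + 1, by omega⟩ := by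
  rw [cupCap_partner, cupCapPartner, if_pos rfl]

theorem cupCap_partner_top (i : ℕ) (hi : i + 1 < n) :
    (cupCap n i hi).partner ⟨2 * n - 2 - i, by omega⟩ = ⟨2 * n - 1 - i, by omega⟩ := by
  apply Fin.ext
  rw [cupCap_partner, cupCapPartner_val]
  dsimp only
  split_ifs <;> omega

/-- A labelling is constant on the arcs of `cupCap` if it is on the four special points and on the
vertical strands. -/
theorem cupCap_label {i : ℕ} (hi : i + 1 < n) {T : Type*} {f : Fin (2 * n) → T}
    (h1 : f ⟨i, by omega⟩ = f ⟨i + 1, by omega⟩)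
    (h2 : f ⟨2 * n - 2 - i, by omega⟩ = f ⟨2 * n - 1 - i, by omega⟩)
    (h3 : ∀ x : Fin (2 * n), x.val < n → x.val ≠ i → x.val ≠ i + 1 → f x = f x.rev)
    (x : Fin (2 * n)) : f ((cupCap n i hi).partner x) = f x := by
  have hx := x.isLt
  by_cases c1 : x.val = i
  · rw [show x = ⟨i, by omega⟩ from Fin.ext c1, cupCap_partner_bot, h1]
  by_cases c2 : x.val = i + 1
  · rw [show x = ⟨i + 1, by omega⟩ from Fin.ext c2, ← cupCap_partner_bot i hi, partner_partner, cupCap_partner_bot, h1]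
  by_cases c3 : x.val = 2 * n - 1 - i
  · rw [show x = ⟨2 * n - 1 - i, by omega⟩ from Fin.ext c3, ← cupCap_partner_top i hi, partner_partner, cupCap_partner_top, h2]
  by_cases c4 : x.val = 2 * n - 2 - i
  · rw [show x = ⟨2 * n - 2 - i, by omega⟩ from Fin.ext c4, cupCap_partner_top, h2]
  rw [cupCap_partner_of_ne i hi c1 c2 c3 c4]
  by_cases c : x.val < n
  · exact (h3 x c c1 c2).symm
  · have := h3 x.rev (by rw [Fin.val_rev]; omega) (by rw [Fin.val_rev]; omega)
      (by rw [Fin.val_rev]; omega)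
    rw [this, Fin.rev_rev]

theorem isCapping_left (i : ℕ) (hi : i + 1 < n) (D : TLDiagram n) :
    IsCapping (cupCap n i hi) D D ⟨2 * n - 2 - i, by omega⟩ ⟨2 * n - 1 - i, by omega⟩ Sum.inr where
  succ := by dsimp only; omega
  reach_strand y h1 h2 := by
    have hy := y.isLt
    rw [ne_eq, Fin.ext_iff] at h1 h2
    by_cases c : y.val < n
    · rw [outer_of_lt c]
    · rw [outer_of_le (not_lt.1 c)]
      have e := cupCap_partner_of_ne i hi (x := y) (by omega) (by omega) h2 h1
      have h3 := stack_adj_inl (cupCap n i hi) D y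
      have h4 := stack_adj_glue (cupCap n i hi) D (x := y.rev) (by rw [Fin.val_rev]; omega)
      rw [e] at h3
      rw [Fin.rev_rev] at h4
      exact h3.reachable.trans h4.reachable
  reach_outer := by
    rw [outer_of_le (by dsimp only; omega), outer_of_le (by dsimp only; omega),
      ← cupCap_partner_top i hi]
    exact (stack_adj_inl _ _ _).reachable
  reach_inner := by
    have h1 := stack_adj_glue (cupCap n i hi) D (x := ⟨i, by omega⟩) (by dsimp only; omega)
    have h2 := stack_adj_glue (cupCap n i hi) D (x := ⟨i + 1, by omega⟩) (by dsimp only; omega)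
    have h3 := stack_adj_inl (cupCap n i hi) D ⟨i, by omega⟩
    rw [cupCap_partner_bot] at h3
    have e1 : (⟨i, by omega⟩ : Fin (2 * n)).rev = ⟨2 * n - 1 - i, by omega⟩ :=
      Fin.ext (by rw [Fin.val_rev]; dsimp only; omega)
    have e2 : (⟨i + 1, by omega⟩ : Fin (2 * n)).rev = ⟨2 * n - 2 - i, by omega⟩ :=
      Fin.ext (by rw [Fin.val_rev]; dsimp only; omega)
    rw [e1] at h1
    rw [e2] at h2
    exact h2.reachable.symm.trans (h3.reachable.symm.trans h1.reachable)
  reach_arc y := (stack_adj_inr _ _ _).reachable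
  cover v := by
    rcases v with x | x
    · by_cases c : x.val < n
      · exact .inr ⟨_, (stack_adj_glue _ _ c).reachable⟩
      · exact .inl ⟨x, (outer_of_le (not_lt.1 c)).symm⟩
    · exact .inr ⟨x, SimpleGraph.Reachable.refl _⟩
  label F L hF hL hLF hLD := by
    refine ⟨Sum.elim (fun y => if y.val < n then L y.rev else F y) L, fun u v => stack_label ?_ ?_ ?_,
      ?_, fun y => rfl⟩
    · refine fun x => cupCap_label hi (f := fun y => if y.val < n then L y.rev else F y) ?_ ?_ ?_ x
      · dsimp only
        rw [if_pos (by omega), if_pos (by omega)]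
        convert hL.symm using 2 <;> (apply Fin.ext; rw [Fin.val_rev]; dsimp only; omega)
      · dsimp only
        rw [if_neg (by omega), if_neg (by omega), hF]
      · intro x h1 h2 h3
        have h4 := Fin.val_rev x
        rw [if_pos h1, if_neg (by omega)]
        refine hLF _ ?_ ?_ <;> (rw [ne_eq, Fin.ext_iff]; dsimp only; omega)
    · exact hLD
    · intro x hx
      simp [hx]
    · intro y
      have hy := y.isLt
      by_cases c : y.val < n
      · rw [outer_of_lt c]
        refine hLF _ ?_ ?_ <;> (rw [ne_eq, Fin.ext_iff]; dsimp only; omega)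
      · rw [outer_of_le (not_lt.1 c), Sum.elim_inl, if_neg c]

theorem isCapping_right (i : ℕ) (hi : i + 1 < n) (D : TLDiagram n) :
    IsCapping D (cupCap n i hi) D ⟨i, by omega⟩ ⟨i + 1, by omega⟩ Sum.inl where
  succ := rfl
  reach_strand y h1 h2 := by
    have hy := y.isLt
    rw [ne_eq, Fin.ext_iff] at h1 h2
    by_cases c : y.val < n
    · rw [outer_of_lt c]
      have e := cupCap_partner_of_ne i hi (x := y) h1 h2 (by omega) (by omega)
      have h3 := stack_adj_inr D (cupCap n i hi) y
      have h4 := stack_adj_glue D (cupCap n i hi) c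
      rw [e] at h3
      exact h3.reachable.trans h4.reachable.symm
    · rw [outer_of_le (not_lt.1 c)]
  reach_outer := by
    rw [outer_of_lt (by dsimp only; omega), outer_of_lt (by dsimp only; omega),
      ← cupCap_partner_bot i hi]
    exact (stack_adj_inr _ _ _).reachable
  reach_inner := by
    have h1 := stack_adj_glue D (cupCap n i hi) (x := ⟨i, by omega⟩) (by dsimp only; omega)
    have h2 := stack_adj_glue D (cupCap n i hi) (x := ⟨i + 1, by omega⟩) (by dsimp only; omega)
    have h3 := stack_adj_inr D (cupCap n i hi) ⟨2 * n - 2 - i, by omega⟩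
    rw [cupCap_partner_top] at h3
    have e1 : (⟨i, by omega⟩ : Fin (2 * n)).rev = ⟨2 * n - 1 - i, by omega⟩ :=
      Fin.ext (by rw [Fin.val_rev]; dsimp only; omega)
    have e2 : (⟨i + 1, by omega⟩ : Fin (2 * n)).rev = ⟨2 * n - 2 - i, by omega⟩ :=
      Fin.ext (by rw [Fin.val_rev]; dsimp only; omega)
    rw [e1] at h1
    rw [e2] at h2
    exact h1.reachable.trans (h3.reachable.symm.trans h2.reachable.symm)
  reach_arc y := (stack_adj_inl _ _ _).reachable
  cover v := by
    rcases v with x | x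
    · exact .inr ⟨x, SimpleGraph.Reachable.refl _⟩
    · by_cases c : x.val < n
      · exact .inl ⟨x, (outer_of_lt c).symm⟩
      · have hx := x.isLt
        have := stack_adj_glue D (cupCap n i hi) (x := x.rev) (by rw [Fin.val_rev]; omega)
        rw [Fin.rev_rev] at this
        exact .inr ⟨_, this.reachable.symm⟩
  label F L hF hL hLF hLD := by
    refine ⟨Sum.elim L (fun y => if y.val < n then F y else L y.rev), fun u v => stack_label ?_ ?_ ?_,
      ?_, fun y => rfl⟩
    · exact hLD
    · refine fun x => cupCap_label hi (f := fun y => if y.val < n then F y else L y.rev) ?_ ?_ ?_ x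
      · dsimp only
        rw [if_pos (by omega), if_pos (by omega), hF]
      · dsimp only
        rw [if_neg (by omega), if_neg (by omega)]
        convert hL.symm using 2 <;> (apply Fin.ext; rw [Fin.val_rev]; dsimp only; omega)
      · intro x h1 h2 h3
        have h4 := Fin.val_rev x
        rw [if_pos h1, if_neg (by omega), Fin.rev_rev]
        symm
        refine hLF _ ?_ ?_ <;> (rw [ne_eq, Fin.ext_iff]; dsimp only; omega)
    · intro x hx
      have h4 := Fin.val_rev x
      simp only [Sum.elim_inl, Sum.elim_inr]
      rw [if_neg (by omega), Fin.rev_rev]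
    · intro y
      have hy := y.isLt
      by_cases c : y.val < n
      · rw [outer_of_lt c, Sum.elim_inr, if_pos c]
      · rw [outer_of_le (not_lt.1 c), Sum.elim_inl]
        refine hLF _ ?_ ?_ <;> (rw [ne_eq, Fin.ext_iff]; dsimp only; omega)

end TLDiagram

namespace TL

open TLDiagram

variable {K : Type*} [Field K] {n : ℕ}

theorem gen_mul_eq (X : TL K n) (i : ℕ) (hi : i + 1 < n) :
    mul 0 (gen K n i hi) X = capped (2 * n - 2 - i) (by omega) X := by
  rw [mul, gen, Finsupp.sum_single_index (by simp), capped, Finsupp.linearCombination_apply]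
  refine Finsupp.sum_congr fun D _ => ?_
  rw [one_mul, (isCapping_left i hi D).diagramMul_eq K]

theorem mul_gen_eq (X : TL K n) (i : ℕ) (hi : i + 1 < n) :
    mul 0 X (gen K n i hi) = capped i (by omega) X := by
  rw [mul, capped, Finsupp.linearCombination_apply]
  refine Finsupp.sum_congr fun D _ => ?_
  rw [gen, Finsupp.sum_single_index (by simp), mul_one, (isCapping_right i hi D).diagramMul_eq K]

end TL

/-! ### Arithmetic of the alternating binomial coefficients -/

/-- By Lucas, the last `s` digits, all `p - 1` above and `0` below, contribute factors `1` and can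
be stripped off. This leaves `u` choose `1`. -/
theorem choose_prime_pow_modEq {p : ℕ} (hp : p.Prime) (s u : ℕ) :
    (p ^ s * u + p ^ s - 1).choose (p ^ s) ≡ u [MOD p] := by
  have := Fact.mk hp
  induction s with
  | zero => simp [Nat.ModEq]
  | succ s ih =>
    have h1 : 0 < p ^ s := pow_pos hp.pos s
    have h0 := hp.pos
    have e : p ^ (s + 1) * u + p ^ (s + 1) - 1 = (p - 1) + p * (p ^ s * u + p ^ s - 1) := by
      obtain ⟨q, hq⟩ : ∃ q, p ^ s * u + p ^ s = q + 1 :=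
        ⟨p ^ s * u + p ^ s - 1, by omega⟩
      have : p ^ (s + 1) * u + p ^ (s + 1) = p * (p ^ s * u + p ^ s) := by ring
      rw [this, hq, Nat.add_sub_cancel, mul_add, mul_one]
      omega
    have h2 := Choose.choose_modEq_choose_mod_mul_choose_div_nat
      (n := p ^ (s + 1) * u + p ^ (s + 1) - 1) (k := p ^ (s + 1)) (p := p)
    rw [show p ^ (s + 1) % p = 0 by rw [pow_succ]; simp, Nat.choose_zero_right, one_mul,
      show p ^ (s + 1) / p = p ^ s by rw [pow_succ, Nat.mul_div_cancel _ h0], e,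
      Nat.add_mul_div_left _ _ h0, Nat.div_eq_of_lt (by omega : p - 1 < p), zero_add] at h2
    rw [e]
    exact h2.trans ih

/-- The product of `j` and the binomial is a multiple of `t + 1 = p ^ s`. If `p` did not divide the
binomial, `p ^ s` would divide `j`, but `0 < j < p ^ s`. -/
theorem prime_dvd_choose_of_prime_pow {p : ℕ} (hp : p.Prime) {s t j : ℕ} (ht : t + 1 = p ^ s)
    (hj : 1 ≤ j) (hjt : j ≤ t) : p ∣ (t + j).choose t := by
  obtain ⟨j, rfl⟩ : ∃ i, j = i + 1 := ⟨j - 1, by omega⟩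
  have h := Nat.choose_succ_right_eq (t + (j + 1)) j
  rw [show t + (j + 1) - j = p ^ s by omega,
    show (t + (j + 1)).choose (j + 1) = (t + (j + 1)).choose t by
      rw [← Nat.choose_symm (by omega : t ≤ t + (j + 1))]
      congr 1
      omega] at h
  by_contra hc
  have hcop : Nat.Coprime (p ^ s) ((t + (j + 1)).choose t) :=
    Nat.Coprime.pow_left _ ((Nat.Prime.coprime_iff_not_dvd hp).2 hc)
  have := Nat.le_of_dvd (Nat.succ_pos j) (hcop.dvd_of_dvd_mul_left (h ▸ Dvd.intro_left _ rfl))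
  omega

theorem altChoose_eq_zero_iff (K : Type*) [Field K] {n : ℕ} (hn : 2 ≤ n) :
    (∀ k, 1 ≤ k → k ≤ n → altChoose K (n + k) n = 0) ↔
      ∃ p : ℕ, 0 < p ∧ CharP K p ∧ ∃ k : ℕ, 0 < k ∧ n + 1 = 2 * p ^ k := by
  constructor
  · intro h
    obtain ⟨t, rfl | rfl⟩ := Nat.even_or_odd' n
    · have := h 1 le_rfl (by omega)
      rw [altChoose_odd_even] at this
      simp at this
    have hch : ∀ j, 1 ≤ j → j ≤ t → ((t + j).choose t : K) = 0 := by
      intro j h1 h2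
      have := h (2 * j) (by omega) (by omega)
      rw [show 2 * t + 1 + 2 * j = 2 * (t + j) + 1 by ring, altChoose_odd_odd] at this
      simpa using this
    obtain ⟨p, hp⟩ := CharP.exists K
    have h1 := hch 1 le_rfl (by omega)
    rw [CharP.cast_eq_zero_iff K p, Nat.choose_succ_self_right] at h1
    have hpp : p.Prime := by
      refine (CharP.char_is_prime_or_zero K p).resolve_right fun h0 => ?_
      rw [h0, zero_dvd_iff] at h1
      omega
    obtain ⟨s, u, hu, hs⟩ := Nat.exists_eq_pow_mul_and_not_dvd (n := t + 1) (by omega) p hpp.ne_one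
    have hs0 : 0 < s := by
      by_contra hc
      rw [show s = 0 by omega, pow_zero, one_mul] at hs
      exact hu (hs ▸ h1)
    refine ⟨p, hpp.pos, hp, s, hs0, ?_⟩
    by_cases hu1 : u = 1
    · rw [hu1, mul_one] at hs
      omega
    exfalso
    have hu0 : u ≠ 0 := fun h0 => hu (h0 ▸ dvd_zero p)
    have hps : 0 < p ^ s := pow_pos hpp.pos s
    have hle : p ^ s * 2 ≤ t + 1 := hs ▸ Nat.mul_le_mul_left _ (by omega)
    -- With `t + 1 = p ^ s * u` and `u > 1`, the choice `j = p ^ s` is admissible, and its binomial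
    -- is congruent to `u`, which `p` does not divide.
    have h2 := hch (p ^ s) hps (by omega)
    rw [CharP.cast_eq_zero_iff K p, ← Nat.choose_symm (by omega : t ≤ t + p ^ s),
      Nat.add_sub_cancel_left, show t + p ^ s = p ^ s * u + p ^ s - 1 by omega] at h2
    exact hu ((Nat.modEq_zero_iff_dvd.1 ((choose_prime_pow_modEq hpp s u).symm.trans
      (Nat.modEq_zero_iff_dvd.2 h2))))
  · rintro ⟨p, hp0, hp, s, hs, hns⟩ k hk1 hk2
    have hpp : p.Prime := (CharP.char_is_prime_or_zero K p).resolve_right hp0.ne'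
    obtain ⟨t, rfl | rfl⟩ := Nat.even_or_odd' n
    · omega
    obtain ⟨j, rfl | rfl⟩ := Nat.even_or_odd' k
    · rw [show 2 * t + 1 + 2 * j = 2 * (t + j) + 1 by ring, altChoose_odd_odd,
        (CharP.cast_eq_zero_iff K p _).2
          (prime_dvd_choose_of_prime_pow (s := s) hpp (by omega) (by omega : 1 ≤ j) (by omega)), mul_zero]
    · rw [show 2 * t + 1 + (2 * j + 1) = 2 * (t + j + 1) by ring, (altChoose_even _).2]

/-! ### Existence and rotatability of the Jones-Wenzl projector -/

namespace TL

open Finset TLDiagram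

variable {K : Type*} [Field K] {n : ℕ}

theorem openers_one (n : ℕ) : (TLDiagram.one n).openers = range n := by
  ext x
  rw [mem_openers, mem_range]
  constructor
  · rintro ⟨h1, h2⟩
    rw [arc_of_lt _ h1, TLDiagram.one, Fin.val_rev] at h2
    dsimp only at h2
    omega
  · intro h
    have h1 : x < 2 * n := by omega
    rw [arc_of_lt _ h1, TLDiagram.one, Fin.val_rev]
    dsimp only
    omega

/-- The bottom row is a transversal only if every arc joins bottom to top, and the identity is the
only such diagram. -/
theorem cupMap_range (X : TL K n) :
    cupMap K n X (range n) =
      X (TLDiagram.one n) * cupVec K (2 * n) (TLDiagram.one n).arc (range n) := by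
  rw [cupMap_apply]
  refine sum_eq_single _ (fun D _ hD => ?_) fun h => ?_
  · rw [cupVec_of_not_transversal, mul_zero]
    refine fun ht => hD (openers_injective ?_)
    rw [openers_one]
    refine eq_of_subset_of_card_le (fun x hx => ?_) (by rw [card_range]; exact D.card_openers.ge)
    rw [mem_openers] at hx
    have := D.transversal_iff.1 ht x hx.1
    rw [mem_range, mem_range] at this
    rw [mem_range]
    omega
  · rw [Finsupp.notMem_support_iff.1 h, zero_mul]

theorem cupVec_one_ne_zero (n : ℕ) : cupVec K (2 * n) (TLDiagram.one n).arc (range n) ≠ 0 := by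
  rw [← openers_one]
  exact cupVec_ne_zero (transversal_openers _)

/-- A rotatable Jones-Wenzl projector is annihilated by all caps. -/
theorem IsJonesWenzl.capped_eq_zero (hn : 2 ≤ n) {X : TL K n} (h : IsJonesWenzl 0 X)
    (hrot : IsRotatable X) (a : ℕ) (ha : a + 1 < 2 * n) : capped a ha X = 0 := by
  have hX : X ≠ 0 := by
    rintro rfl
    simpa using h.coeff_one
  rcases lt_trichotomy (a + 1) n with hlt | heq | hgt
  · rw [← mul_gen_eq X a hlt]
    exact h.mul_gen a hlt
  · obtain ⟨b, rfl⟩ : ∃ b, a = b + 1 := ⟨a - 1, by omega⟩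
    obtain ⟨c, hc⟩ := hrot.1
    have h1 := capped_rotateCCW X ha
    rw [← mul_gen_eq X b (by omega), h.mul_gen, hc, map_smul, Finsupp.mapDomain_zero,
      smul_eq_zero] at h1
    refine h1.resolve_left fun h0 => mapDomain_rotateCCW_ne_zero hX ?_
    rw [hc, h0, zero_smul]
  · have hi : 2 * n - 2 - a + 1 < n := by omega
    have := gen_mul_eq X (2 * n - 2 - a) hi
    rw [h.gen_mul] at this
    simp only [show 2 * n - 2 - (2 * n - 2 - a) = a by omega] at this
    exact this.symm

theorem IsJonesWenzl.altChoose_eq_zero (hn : 2 ≤ n) {X : TL K n} (h : IsJonesWenzl 0 X)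
    (hrot : IsRotatable X) (k : ℕ) (hk1 : 1 ≤ k) (hk2 : k ≤ n) : altChoose K (n + k) n = 0 := by
  have hT : range (n + k) ⊆ range (2 * n) := range_mono (by omega)
  have h1 := altSum_cupSpan (cupMap_mem_cupSpan X) hT (by rw [card_range]; omega)
  rw [altSum_congr (v := cupMap K n X (range n) • fun _ => 1), map_smul, altSum_one, card_range,
    cupMap_range, h.coeff_one, one_mul, smul_eq_mul] at h1
  · exact (mul_eq_zero.1 h1).resolve_left (cupVec_one_ne_zero n)
  · intro S hS hc
    rw [cupMap_eq_of_capped (h.capped_eq_zero hn hrot) (hS.trans hT) hc]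
    simp

/-- The rotation `Y` of `X` is annihilated by all caps except possibly the first, which may be
omitted for odd `n`. So both vectors are constant and hence proportional. The clockwise rotation
follows by inverting the factor. -/
theorem isRotatable_of_capped (hn : Odd n) {X : TL K n}
    (h : ∀ a (ha : a + 1 < 2 * n), capped a ha X = 0) (hX : X (TLDiagram.one n) ≠ 0) :
    IsRotatable X := by
  have hX0 : X ≠ 0 := by
    rintro rfl
    simp at hX
  have hx : cupMap K n X (range n) ≠ 0 := by
    rw [cupMap_range]
    exact mul_ne_zero hX (cupVec_one_ne_zero n)
  obtain ⟨Y, hY⟩ : ∃ Y, Y = Finsupp.mapDomain rotateCCW X := ⟨_, rfl⟩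
  have hcap : ∀ a (ha : a + 1 < 2 * n), 1 ≤ a → capped a ha Y = 0 := by
    intro a ha h1
    obtain ⟨b, rfl⟩ : ∃ b, a = b + 1 := ⟨a - 1, by omega⟩
    rw [hY, capped_rotateCCW, h, Finsupp.mapDomain_zero]
  obtain ⟨c, hc⟩ : ∃ c : K, Y = c • X := by
    refine ⟨cupMap K n Y (range n) / cupMap K n X (range n), sub_eq_zero.1 ?_⟩
    refine eq_zero_of_cupMap fun S hS hcard => ?_
    rw [map_sub, map_smul, Pi.sub_apply, Pi.smul_apply, cupMap_eq_of_capped h hS hcard,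
      cupMap_eq_of_capped_pos hn hcap hS hcard, smul_eq_mul, div_mul_cancel₀ _ hx, sub_self]
  have hc0 : c ≠ 0 := fun h0 => mapDomain_rotateCCW_ne_zero hX0 (by
    rw [← hY, hc, h0, zero_smul])
  refine ⟨⟨c, hY ▸ hc⟩, c⁻¹, ?_⟩
  have h1 := mapDomain_rotateCW_rotateCCW X
  rw [← hY, hc, Finsupp.mapDomain_smul] at h1
  rw [eq_inv_smul_iff₀ hc0, h1]

theorem exists_isJonesWenzl (hn : Odd n)
    (h : ∀ k, 1 ≤ k → k ≤ n → altChoose K (n + k) n = 0) :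
    ∃ X : TL K n, IsJonesWenzl (0 : K) X ∧ IsRotatable X := by
  obtain ⟨w, hw, hw1⟩ := exists_mem_cupSpan (2 * n) n (fun _ => (1 : K)) fun T hT hlt => by
    have h1 := card_le_card hT
    rw [card_range] at h1
    rw [altSum_one, ← h (#T - n) (by omega) (by omega), Nat.add_sub_cancel' hlt.le]
  obtain ⟨X, rfl⟩ := exists_cupMap_eq hw
  have hcap : ∀ a (ha : a + 1 < 2 * n), capped a ha X = 0 := by
    intro a ha
    refine capped_eq_zero_of_cupMap ha fun S hS hc h1 h2 => ?_
    rw [← hw1 S hS hc, ← hw1]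
    · exact insert_subset (mem_range.2 ha) ((erase_subset _ _).trans hS)
    · rw [card_insert_of_notMem (by simp [h2]), card_erase_add_one h1, hc]
  have hone : X (TLDiagram.one n) ≠ 0 := by
    intro h0
    have := hw1 (range n) (range_mono (by omega)) (card_range n)
    rw [cupMap_range, h0, zero_mul] at this
    exact one_ne_zero this
  have hcap' : ∀ a (ha : a + 1 < 2 * n), capped a ha ((X (TLDiagram.one n))⁻¹ • X) = 0 := by
    intro a ha
    rw [map_smul, hcap, smul_zero]
  have hone' : ((X (TLDiagram.one n))⁻¹ • X) (TLDiagram.one n) = 1 := by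
    rw [Finsupp.smul_apply, smul_eq_mul, inv_mul_cancel₀ hone]
  refine ⟨(X (TLDiagram.one n))⁻¹ • X, ⟨hone', fun i hi => ?_, fun i hi => ?_⟩,
    isRotatable_of_capped hn hcap' (by rw [hone']; exact one_ne_zero)⟩
  · rw [gen_mul_eq, hcap']
  · rw [mul_gen_eq, hcap']

end TL

/-- For a field `K` and `2 < m < ∞`, the Jones-Wenzl projector of the Temperley-Lieb algebra
`TL_{m-1}(0)` over `K` exists and is rotatable if and only if `K` has positive characteristic `p`
and `m = 2 p ^ k` for some `k > 0`. -/
theorem lemma4 (K : Type*) [Field K] (m : ℕ) (hm : 2 < m) :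
    (∃ X : TL K (m - 1), TL.IsJonesWenzl (0 : K) X ∧ TL.IsRotatable X) ↔
      ∃ p : ℕ, 0 < p ∧ CharP K p ∧ ∃ k : ℕ, 0 < k ∧ m = 2 * p ^ k := by
  obtain ⟨n, rfl⟩ : ∃ n, m = n + 1 := ⟨m - 1, by omega⟩
  rw [Nat.add_sub_cancel]
  have hn : 2 ≤ n := by omega
  constructor
  · rintro ⟨X, hX, hrot⟩
    exact (altChoose_eq_zero_iff K hn).1 (hX.altChoose_eq_zero hn hrot)
  · intro h
    -- The oddness of `n` needed for rotatability is read off from `n + 1 = 2 * p ^ k`.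
    refine TL.exists_isJonesWenzl ?_ ((altChoose_eq_zero_iff K hn).2 h)
    obtain ⟨p, -, -, k, -, hk⟩ := h
    rw [Nat.odd_iff]
    omega
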